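/- Let $k$ be a field, let $n\ge 0$, and let $R=k[x_0,\dots,x_n]$ be the coordinate ring of $\mathbb P^n$ over $k$, with its standard grading. Let $P_0,\dots,P_r\in\mathbb P^n(k)$, $0\le r\le n$, be points in general position, that is, represented by linearly independent vectors of $k^{n+1}$ (equivalently, up to a linear change of coordinates they are the first $r+1$ coordinate points), and let $a_0,\dots,a_r\ge 1$ be integers. Let $\mathfrak p_i\subset R$ be the homogeneous ideal of $P_i$, and let $I=\mathfrak p_0^{a_0}\cap\cdots\cap\mathfrak p_r^{a_r}$ be the ideal of the fat points $(P_0,a_0),\dots,(P_r,a_r)$. For $d\ge 0$ let $I_{<d>}$ denote the ideal of $R$ generated by all homogeneous elements of degree $d$ of $I$. For a homogeneous ideal $J\subset R$, let $\beta_{i,j}(R/J)$ be the number of summands $R(-j)$ in the $i$-th free module of the minimal graded free resolution of $R/J$ over $R$, and let $\beta_i(R/J)=\sum_j\beta_{i,j}(R/J)$ be the rank of that module. Then, for all integers $i\ge 1$ and $d\ge 0$, $$\beta_{i,i+d}(R/I)=\beta_i(R/I_{<d+1>})+\beta_{i+1}(R/I_{<d>})-\beta_1(R/I_{<d>})\binom{n+1}{i},$$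 while $\beta_{0,0}(R/I)=1$ and $\beta_{0,d}(R/I)=0$ for all $d\ge 1$. -/

import Mathlib

open MvPolynomial
open scoped LinearAlgebra.Projectivization

namespace FatPoints

/-- The coordinate ring `R = k[x₀, …, xₙ]` of projective `n`-space. -/
abbrev CoordRing (k : Type*) [Field k] (n : ℕ) : Type _ := MvPolynomial (Fin (n + 1)) k

section Ideals

variable {k : Type*} [Field k] {n : ℕ}

/-- The homogeneous ideal of a point of projective space: it is generated by the homogeneous
polynomials that vanish at the point (for a homogeneous polynomial this does not depend on the
representative of the point). -/
noncomputable def pointIdeal (P : ℙ k (Fin (n + 1) → k)) : Ideal (CoordRing k n) :=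
  Ideal.span {f | (∃ m : ℕ, f.IsHomogeneous m) ∧ eval P.rep f = 0}

/-- The ideal `𝔭₀ ^ a₀ ∩ ⋯ ∩ 𝔭ᵣ ^ aᵣ` of the fat points `(P₀, a₀), …, (Pᵣ, aᵣ)`. -/
noncomputable def fatPointIdeal {r : ℕ} (P : Fin (r + 1) → ℙ k (Fin (n + 1) → k)) (a : Fin (r + 1) → ℕ) :
    Ideal (CoordRing k n) :=
  ⨅ i, pointIdeal (P i) ^ a i

/-- `J_{<d>}`: the ideal generated by the homogeneous elements of degree `d` in `J`. -/
noncomputable def component (J : Ideal (CoordRing k n)) (d : ℕ) : Ideal (CoordRing k n) :=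
  Ideal.span {f | f ∈ J ∧ f.IsHomogeneous d}

/-- An element `v` of the graded free module `⨁ b, R(-s b)` is homogeneous of degree `e`: its
coordinate `v b` is homogeneous of degree `e - s b` (and zero if `e < s b`). -/
def IsHomogeneousVec {m : ℕ} (s : Fin m → ℕ) (e : ℕ) (v : Fin m → CoordRing k n) : Prop :=
  ∀ b, ∀ u ∈ (v b).support, u.degree + s b = e

/-- A minimal graded free resolution
`⋯ → F₂ → F₁ → F₀ → R/J → 0` with `Fᵢ = ⨁ b, R(-(shift i b))` of finite rank `rank i`.
(Since `R/J` lives in nonnegative degrees, no negative shifts can occur.) -/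
structure MinimalGradedFreeResolution (J : Ideal (CoordRing k n)) where
  /-- the rank of `Fᵢ` -/
  rank : ℕ → ℕ
  /-- the degrees of the basis elements of `Fᵢ` -/
  shift : ∀ i, Fin (rank i) → ℕ
  /-- the augmentation `F₀ → R/J` -/
  aug : (Fin (rank 0) → CoordRing k n) →ₗ[CoordRing k n] (CoordRing k n ⧸ J)
  /-- the differential `Fᵢ₊₁ → Fᵢ` -/
  diff : ∀ i, (Fin (rank (i + 1)) → CoordRing k n) →ₗ[CoordRing k n] (Fin (rank i) → CoordRing k n)
  /-- the augmentation has degree zero -/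
  aug_homogeneous : ∀ b, ∃ p : CoordRing k n, p.IsHomogeneous (shift 0 b) ∧
    aug (Pi.single b 1) = Ideal.Quotient.mk J p
  /-- the differentials have degree zero -/
  diff_homogeneous : ∀ i b, IsHomogeneousVec (shift i) (shift (i + 1) b) (diff i (Pi.single b 1))
  aug_surjective : Function.Surjective aug
  exact_zero : LinearMap.ker aug = LinearMap.range (diff 0)
  exact_succ : ∀ i, LinearMap.ker (diff i) = LinearMap.range (diff (i + 1))
  /-- minimality: the matrices of the differentials have entries in `𝔪 = (x₀, …, xₙ)` -/
  minimal : ∀ i b c, diff i (Pi.single b 1) c ∈ idealOfVars (Fin (n + 1)) k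

namespace MinimalGradedFreeResolution

variable {J : Ideal (CoordRing k n)}

/-- The graded Betti number `β_{i,j}(R/J)`: the number of copies of `R(-j)` in `Fᵢ`. -/
def gradedBetti (F : MinimalGradedFreeResolution J) (i j : ℕ) : ℕ :=
  (Finset.univ.filter fun b => F.shift i b = j).card

/-- The total Betti number `β_i(R/J)`: the rank of `Fᵢ`. -/
def betti (F : MinimalGradedFreeResolution J) (i : ℕ) : ℕ := F.rank i

end MinimalGradedFreeResolution

end Ideals

section Existence

/-! Existence of minimal graded free resolutions, so that statements about all of them are not
vacuous. -/

attribute [local instance] MvPolynomial.gradedAlgebra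

variable {k : Type*} [Field k] {n : ℕ}

/-- The projection of `⨁ b, R(-s b)` to its part of degree `e`. -/
noncomputable def vecComponent {m : ℕ} (s : Fin m → ℕ) (e : ℕ) :
    (Fin m → CoordRing k n) →ₗ[k] (Fin m → CoordRing k n) :=
  LinearMap.pi fun b =>
    (if s b ≤ e then (homogeneousComponent (e - s b) : CoordRing k n →ₗ[k] CoordRing k n) else 0) ∘ₗ
      LinearMap.proj b

theorem coeff_vecComponent {m : ℕ} (s : Fin m → ℕ) (e : ℕ) (v : Fin m → CoordRing k n) (b : Fin m)
    (u : Fin (n + 1) →₀ ℕ) :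
    coeff u (vecComponent s e v b) = if u.degree + s b = e then coeff u (v b) else 0 := by
  by_cases h : s b ≤ e
  · have : (u.degree = e - s b) = (u.degree + s b = e) := by
      apply propext; omega
    simp [vecComponent, h, coeff_homogeneousComponent, this]
  · have : ¬ (u.degree + s b = e) := by omega
    simp [vecComponent, h, this]

theorem vecComponent_of_homogeneous {m : ℕ} {s : Fin m → ℕ} {e' : ℕ} {v : Fin m → CoordRing k n}
    (hv : IsHomogeneousVec s e' v) (e : ℕ) :
    vecComponent s e v = if e' = e then v else 0 := by
  funext b
  ext u
  rw [coeff_vecComponent]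
  by_cases hu : coeff u (v b) = 0
  · split_ifs <;> simp [hu]
  · have := hv b u (mem_support_iff.2 hu)
    subst this
    split_ifs <;> simp

theorem isHomogeneousVec_vecComponent {m : ℕ} (s : Fin m → ℕ) (e : ℕ) (v : Fin m → CoordRing k n) :
    IsHomogeneousVec s e (vecComponent s e v) := by
  intro b u hu
  rw [mem_support_iff, coeff_vecComponent] at hu
  by_contra h
  simp [h] at hu

theorem sum_vecComponent {m : ℕ} (s : Fin m → ℕ) (v : Fin m → CoordRing k n) :
    ∃ T : Finset ℕ, ∑ e ∈ T, vecComponent s e v = v := by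
  classical
  refine ⟨Finset.univ.biUnion fun b => (v b).support.image fun u => u.degree + s b, ?_⟩
  funext b
  ext u
  rw [Finset.sum_apply, coeff_sum]
  simp_rw [coeff_vecComponent]
  rw [Finset.sum_ite_eq]
  split_ifs with h
  · rfl
  · by_contra h0
    refine h (Finset.mem_biUnion.2 ⟨b, Finset.mem_univ _, Finset.mem_image.2 ⟨u, ?_, rfl⟩⟩)
    exact mem_support_iff.2 fun h1 => h0 h1.symm

theorem IsHomogeneousVec.monomial_smul {m : ℕ} {s : Fin m → ℕ} {e : ℕ} {v : Fin m → CoordRing k n}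
    (hv : IsHomogeneousVec s e v) (u : Fin (n + 1) →₀ ℕ) (a : k) :
    IsHomogeneousVec s (u.degree + e) ((monomial u a : CoordRing k n) • v) := by
  intro b w hw
  rw [mem_support_iff, Pi.smul_apply, smul_eq_mul, coeff_monomial_mul'] at hw
  split_ifs at hw with h
  · have h1 : coeff (w - u) (v b) ≠ 0 := fun h0 => hw (by simp [h0])
    have h2 := hv b _ (mem_support_iff.2 h1)
    have h3 : u.degree + (w - u).degree = w.degree := by
      rw [← map_add, add_tsub_cancel_of_le h]
    omega
  · exact absurd rfl hw

theorem map_vecComponent {m m' : ℕ} {s : Fin m → ℕ} {s' : Fin m' → ℕ}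
    (φ : (Fin m' → CoordRing k n) →ₗ[CoordRing k n] (Fin m → CoordRing k n))
    (hφ : ∀ b, IsHomogeneousVec s (s' b) (φ (Pi.single b 1))) (e : ℕ) (c : Fin m' → CoordRing k n) :
    φ (vecComponent s' e c) = vecComponent s e (φ c) := by
  have key : (φ.restrictScalars k) ∘ₗ vecComponent s' e = vecComponent s e ∘ₗ φ.restrictScalars k := by
    refine LinearMap.pi_ext fun b p => ?_
    induction p using MvPolynomial.induction_on' with
    | monomial u a =>
      have h1 : (Pi.single b (monomial u a) : Fin m' → CoordRing k n)
          = (monomial u a : CoordRing k n) • Pi.single b 1 := by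
        rw [← Pi.single_smul]; simp
      have h2 : IsHomogeneousVec (k := k) (n := n) s' (u.degree + s' b)
          ((monomial u a : CoordRing k n) • Pi.single b 1) := by
        apply IsHomogeneousVec.monomial_smul
        intro b' w hw
        by_cases hb : b' = b
        · subst hb
          rw [Pi.single_eq_same, mem_support_iff, coeff_one] at hw
          have : w = 0 := by
            by_contra h; exact hw (if_neg fun h' => h h'.symm)
          simp [this]
        · simp [Pi.single_eq_of_ne hb] at hw
      have h3 := (hφ b).monomial_smul u a
      simp only [LinearMap.comp_apply, LinearMap.restrictScalars_apply]
      rw [h1, vecComponent_of_homogeneous h2, map_smul, vecComponent_of_homogeneous h3]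
      split_ifs <;> simp
    | add p q hp hq =>
      rw [Pi.single_add, map_add, map_add, hp, hq]
  exact LinearMap.congr_fun key c

/-- A graded submodule of `⨁ b, R(-s b)`. -/
def IsGradedSubmodule {m : ℕ} (s : Fin m → ℕ)
    (N : Submodule (CoordRing k n) (Fin m → CoordRing k n)) : Prop :=
  ∀ v ∈ N, ∀ e, vecComponent s e v ∈ N

theorem exists_homogeneous_generators {m : ℕ} (s : Fin m → ℕ)
    (N : Submodule (CoordRing k n) (Fin m → CoordRing k n)) (hN : IsGradedSubmodule s N) :
    ∃ (m' : ℕ) (s' : Fin m' → ℕ) (g : Fin m' → Fin m → CoordRing k n),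
      (∀ b, IsHomogeneousVec s (s' b) (g b)) ∧
      Submodule.span (CoordRing k n) (Set.range g) = N := by
  classical
  obtain ⟨S, hS⟩ := (isNoetherian_def.1 inferInstance N : N.FG)
  choose T hT using fun v : Fin m → CoordRing k n => sum_vecComponent s v
  let A : Finset ((_ : Fin m → CoordRing k n) × ℕ) := S.sigma T
  let eqv := A.equivFin.symm
  refine ⟨A.card, fun b => (eqv b).1.2, fun b => vecComponent s (eqv b).1.2 (eqv b).1.1,
    fun b => isHomogeneousVec_vecComponent _ _ _, le_antisymm ?_ ?_⟩
  · rw [Submodule.span_le]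
    rintro _ ⟨b, rfl⟩
    refine hN _ ?_ _
    rw [← hS]
    exact Submodule.subset_span (Finset.mem_sigma.1 (eqv b).2).1
  · conv_lhs => rw [← hS]
    rw [Submodule.span_le]
    intro v hv
    rw [SetLike.mem_coe, ← hT v]
    refine Submodule.sum_mem _ fun e he => Submodule.subset_span ?_
    refine ⟨eqv.symm ⟨⟨v, e⟩, Finset.mem_sigma.2 ⟨hv, he⟩⟩, ?_⟩
    simp

theorem mem_idealOfVars_iff (p : CoordRing k n) :
    p ∈ idealOfVars (Fin (n + 1)) k ↔ coeff 0 p = 0 := by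
  have := mem_pow_idealOfVars_iff' (σ := Fin (n + 1)) (R := k) 1 p
  rw [pow_one] at this
  rw [this]
  constructor
  · intro h
    exact h 0 (by simp)
  · intro h x hx
    have : x = 0 := by
      rw [Nat.lt_one_iff] at hx
      exact (Finsupp.degree_eq_zero_iff x).1 hx
    rw [this, h]

theorem exists_minimal_cover {m : ℕ} (s : Fin m → ℕ)
    (N : Submodule (CoordRing k n) (Fin m → CoordRing k n)) (hN : IsGradedSubmodule s N) :
    ∃ (m' : ℕ) (s' : Fin m' → ℕ) (φ : (Fin m' → CoordRing k n) →ₗ[CoordRing k n] (Fin m → CoordRing k n)),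
      (∀ b, IsHomogeneousVec s (s' b) (φ (Pi.single b 1))) ∧ LinearMap.range φ = N ∧
      IsGradedSubmodule s' (LinearMap.ker φ) ∧
      ∀ v ∈ LinearMap.ker φ, ∀ b, v b ∈ idealOfVars (Fin (n + 1)) k := by
  classical
  have hex := exists_homogeneous_generators s N hN
  obtain ⟨s', g, hg, hspan⟩ := Nat.find_spec hex
  have hmin := fun j (hj : j < Nat.find hex) => Nat.find_min hex hj
  generalize Nat.find hex = m' at s' g hg hspan hmin
  let φ : (Fin m' → CoordRing k n) →ₗ[CoordRing k n] (Fin m → CoordRing k n) :=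
    Fintype.linearCombination (CoordRing k n) g
  have hφ1 : ∀ b, φ (Pi.single b 1) = g b := fun b => by
    simp [φ, Fintype.linearCombination_apply_single]
  have hφ2 : ∀ b, IsHomogeneousVec s (s' b) (φ (Pi.single b 1)) := fun b => by
    rw [hφ1]; exact hg b
  have hker : IsGradedSubmodule s' (LinearMap.ker φ) := by
    intro v hv e
    rw [LinearMap.mem_ker] at hv ⊢
    rw [map_vecComponent φ hφ2, hv, map_zero]
  refine ⟨m', s', φ, hφ2, ?_, hker, ?_⟩
  · rw [← hspan]
    exact Fintype.range_linearCombination (CoordRing k n) g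
  · intro v hv b
    rw [mem_idealOfVars_iff]
    by_contra h0
    have hw := hker v hv (s' b)
    set w := vecComponent s' (s' b) v with hwdef
    have hwb : w b = C (coeff 0 (v b)) := by
      ext u
      rw [hwdef, coeff_vecComponent, coeff_C]
      by_cases hu : u = 0
      · subst hu; simp
      · have h1 : ¬ (u.degree + s' b = s' b) := by
          intro h
          exact hu ((Finsupp.degree_eq_zero_iff u).1 (by omega))
        rw [if_neg h1, if_neg fun h => hu h.symm]
    obtain ⟨l, rfl⟩ : ∃ l, m' = l + 1 := ⟨m' - 1, by have := b.2; omega⟩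
    have hsum : w b • g b + ∑ i : Fin l, w (b.succAbove i) • g (b.succAbove i) = 0 := by
      rw [← Fin.sum_univ_succAbove (fun i => w i • g i) b]
      exact hw
    refine hmin l (Nat.lt_succ_self l) ⟨s' ∘ b.succAbove, g ∘ b.succAbove, fun i => hg _, ?_⟩
    rw [← hspan]
    refine le_antisymm (Submodule.span_mono (Set.range_comp_subset_range _ _)) ?_
    rw [Submodule.span_le]
    rintro _ ⟨i, rfl⟩
    rw [SetLike.mem_coe]
    have hother : ∀ j, g (b.succAbove j) ∈
        Submodule.span (CoordRing k n) (Set.range (g ∘ b.succAbove)) :=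
      fun j => Submodule.subset_span ⟨j, rfl⟩
    rcases Fin.eq_self_or_eq_succAbove b i with rfl | ⟨j, rfl⟩
    · have h1 : w i • g i ∈ Submodule.span (CoordRing k n) (Set.range (g ∘ i.succAbove)) := by
        rw [eq_neg_of_add_eq_zero_left hsum]
        exact Submodule.neg_mem _ (Submodule.sum_mem _ fun j _ =>
          Submodule.smul_mem _ _ (hother j))
      have h2 : g i = (C (coeff 0 (v i))⁻¹ : CoordRing k n) • (w i • g i) := by
        rw [hwb, smul_smul, ← C_mul, inv_mul_cancel₀ h0, C_1, one_smul]
      rw [h2]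
      exact Submodule.smul_mem _ _ h1
    · exact hother j

/-- A graded free module with a graded submodule contained in `𝔪 F`. -/
structure Stage (k : Type*) [Field k] (n : ℕ) where
  m : ℕ
  s : Fin m → ℕ
  N : Submodule (CoordRing k n) (Fin m → CoordRing k n)
  graded : IsGradedSubmodule s N
  le : ∀ v ∈ N, ∀ b, v b ∈ idealOfVars (Fin (n + 1)) k

theorem Stage.exists_next (A : Stage k n) :
    ∃ (B : Stage k n) (φ : (Fin B.m → CoordRing k n) →ₗ[CoordRing k n] (Fin A.m → CoordRing k n)),
      (∀ b, IsHomogeneousVec A.s (B.s b) (φ (Pi.single b 1))) ∧ LinearMap.range φ = A.N ∧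
      LinearMap.ker φ = B.N := by
  obtain ⟨m', s', φ, h1, h2, h3, h4⟩ := exists_minimal_cover A.s A.N A.graded
  exact ⟨⟨m', s', LinearMap.ker φ, h3, h4⟩, φ, h1, h2, rfl⟩

/-- Every proper homogeneous ideal has a minimal graded free resolution. -/
theorem MinimalGradedFreeResolution.nonempty (J : Ideal (CoordRing k n)) (hJ : J ≠ ⊤)
    (hom : ∀ f ∈ J, ∀ e, homogeneousComponent e f ∈ J) :
    Nonempty (MinimalGradedFreeResolution J) := by
  choose next φ h1 h2 h3 using Stage.exists_next (k := k) (n := n)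
  let A₀ : Stage k n :=
    { m := 1
      s := fun _ => 0
      N := Submodule.comap (LinearMap.proj (0 : Fin 1) :
        (Fin 1 → CoordRing k n) →ₗ[CoordRing k n] CoordRing k n) J
      graded := by
        intro v hv e
        have := hom _ hv e
        simpa [Submodule.mem_comap, vecComponent] using this
      le := by
        intro v hv b
        rw [Subsingleton.elim b 0, mem_idealOfVars_iff]
        by_contra h0
        refine hJ (Ideal.eq_top_of_isUnit_mem J (hom _ hv 0) ?_)
        rw [LinearMap.proj_apply, homogeneousComponent_zero]
        exact (isUnit_iff_ne_zero.2 h0).map C }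
  let A : ℕ → Stage k n := fun i => Nat.rec A₀ (fun _ B => next B) i
  refine ⟨⟨fun i => (A i).m, fun i => (A i).s,
    (Submodule.mkQ J).comp (LinearMap.proj (0 : Fin 1)), fun i => φ (A i), ?_, fun i => h1 (A i),
    ?_, ?_, fun i => ?_, fun i b c => ?_⟩⟩
  · intro (b : Fin 1)
    refine ⟨1, isHomogeneous_one _ _, ?_⟩
    obtain rfl : b = 0 := Subsingleton.elim _ _
    rfl
  · intro y
    obtain ⟨x, rfl⟩ := Submodule.mkQ_surjective J y
    exact ⟨fun _ => x, rfl⟩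
  · rw [h2, LinearMap.ker_comp, Submodule.ker_mkQ]
    rfl
  · rw [h2, h3]
  · refine (A i).le _ ?_ c
    rw [← h2]
    exact LinearMap.mem_range_self _ _

theorem pointIdeal_isHomogeneous (P : ℙ k (Fin (n + 1) → k)) :
    (pointIdeal P).IsHomogeneous (homogeneousSubmodule (Fin (n + 1)) k) :=
  Ideal.homogeneous_span _ _ fun _ hf => hf.1

theorem pointIdeal_ne_top (P : ℙ k (Fin (n + 1) → k)) : pointIdeal P ≠ ⊤ := by
  intro h
  have hle : pointIdeal P ≤ RingHom.ker (eval P.rep) :=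
    Ideal.span_le.2 fun f hf => hf.2
  exact RingHom.ker_ne_top (eval P.rep) (top_le_iff.1 (h ▸ hle))

theorem fatPointIdeal_isHomogeneous {r : ℕ} (P : Fin (r + 1) → ℙ k (Fin (n + 1) → k))
    (a : Fin (r + 1) → ℕ) :
    (fatPointIdeal P a).IsHomogeneous (homogeneousSubmodule (Fin (n + 1)) k) := by
  refine Ideal.IsHomogeneous.iInf fun i => ?_
  induction a i with
  | zero => rw [pow_zero, Ideal.one_eq_top]; exact Ideal.IsHomogeneous.top _
  | succ m ih => rw [pow_succ]; exact ih.mul (pointIdeal_isHomogeneous _)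

theorem fatPointIdeal_ne_top {r : ℕ} (P : Fin (r + 1) → ℙ k (Fin (n + 1) → k))
    (a : Fin (r + 1) → ℕ) (ha : ∀ i, 1 ≤ a i) : fatPointIdeal P a ≠ ⊤ := fun h =>
  pointIdeal_ne_top (P 0) <| top_le_iff.1 <| h ▸ (iInf_le _ 0).trans
    (Ideal.pow_le_self (Nat.one_le_iff_ne_zero.1 (ha 0)))

/-- The ideals of fat points have minimal graded free resolutions. -/
theorem nonempty_resolution_fatPointIdeal {r : ℕ} (P : Fin (r + 1) → ℙ k (Fin (n + 1) → k))
    (a : Fin (r + 1) → ℕ) (ha : ∀ i, 1 ≤ a i) :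
    Nonempty (MinimalGradedFreeResolution (fatPointIdeal P a)) :=
  MinimalGradedFreeResolution.nonempty _ (fatPointIdeal_ne_top P a ha) fun _ hf _ =>
    homogeneousComponent_mem_of_mem (fatPointIdeal_isHomogeneous P a) hf _

/-- So do the ideals generated by their graded pieces. -/
theorem nonempty_resolution_component {r : ℕ} (P : Fin (r + 1) → ℙ k (Fin (n + 1) → k))
    (a : Fin (r + 1) → ℕ) (ha : ∀ i, 1 ≤ a i) (d : ℕ) :
    Nonempty (MinimalGradedFreeResolution (component (fatPointIdeal P a) d)) := by
  refine MinimalGradedFreeResolution.nonempty _ (fun h => fatPointIdeal_ne_top P a ha ?_)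
    fun _ hf _ => homogeneousComponent_mem_of_mem
      (Ideal.homogeneous_span _ _ fun f hf => ⟨d, hf.2⟩) hf _
  exact top_le_iff.1 (h ▸ Ideal.span_le.2 fun f hf => hf.1)

end Existence

end FatPoints

namespace FatPoints

/-! ### Koszul complexes with coefficients in a chain of subspaces -/

section Koszul

set_option linter.unusedSectionVars false

/-! The graded Betti number β_{q+1,j}(R/J) is the dimension of the degree j part of the q-th Koszul
homology of J, whose p-chains have coefficients in J_{j-p} (`gradedBetti_succ`). This follows by
dimension shifting along the given minimal resolution, and the Koszul complex may be taken on any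
linear system of coordinates.

The key fact is that every I_{<d>} has a linear resolution (`koszulDim_component_eq_zero`). In
coordinates adapted to the points, I is spanned by the monomials x^v with deg v - v_{c_t} ≥ a_t for
all t. The Koszul complex splits by multidegree u; wedging with the i-th basis vector and dividing
by x_i contracts the piece of multidegree u when u_i ≠ 0, and off the linear strand
`exists_divisible_index` chooses i so that this division does not leave I_{<d>}.

Hence β_{p+1}(R/I_{<d>}) is Koszul homology in total degree d + p only. There are no boundaries
there, since I_{<d>} vanishes in degree d - 1, and I_{<d>} agrees with I in degree d. So this Betti
number is the dimension of the Koszul p-cycles with coefficients in I_d (`betti_component`); for p =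
0 it is dim I_d.

The formula is then a count. With i = p + 1, the left side is the dimension of the p-cycles over
I_{d+1} minus that of the boundaries of (p+1)-chains over I_d. By rank-nullity the boundaries have
dimension binom(n+1, p+1) · dim I_d minus that of the (p+1)-cycles over I_d. -/

theorem finrank_quotient_eq_of_correspondence {k V V₁ V₂ : Type*} [Field k]
    [AddCommGroup V] [Module k V] [AddCommGroup V₁] [Module k V₁] [AddCommGroup V₂] [Module k V₂]
    (W : Submodule k V) (Z₁ B₁ : Submodule k V₁) (Z₂ B₂ : Submodule k V₂)
    (α : V →ₗ[k] V₁) (β : V →ₗ[k] V₂) (hα : W.map α = Z₁) (hβ : W.map β = Z₂)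
    (h : ∀ w ∈ W, α w ∈ B₁ ↔ β w ∈ B₂) :
    Module.finrank k (Z₁ ⧸ B₁.submoduleOf Z₁) = Module.finrank k (Z₂ ⧸ B₂.submoduleOf Z₂) := by
  have h₁ : ∀ w ∈ W, α w ∈ Z₁ := fun w hw => hα ▸ Submodule.mem_map_of_mem hw
  have h₂ : ∀ w ∈ W, β w ∈ Z₂ := fun w hw => hβ ▸ Submodule.mem_map_of_mem hw
  let f₁ : W →ₗ[k] Z₁ ⧸ B₁.submoduleOf Z₁ :=
    (Submodule.mkQ _).comp (α.restrict h₁)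
  let f₂ : W →ₗ[k] Z₂ ⧸ B₂.submoduleOf Z₂ :=
    (Submodule.mkQ _).comp (β.restrict h₂)
  have s₁ : Function.Surjective f₁ := by
    refine (Submodule.mkQ_surjective _).comp ?_
    rintro ⟨z, hz⟩
    obtain ⟨w, hw, rfl⟩ := (Submodule.mem_map).1 (hα ▸ hz)
    exact ⟨⟨w, hw⟩, rfl⟩
  have s₂ : Function.Surjective f₂ := by
    refine (Submodule.mkQ_surjective _).comp ?_
    rintro ⟨z, hz⟩
    obtain ⟨w, hw, rfl⟩ := (Submodule.mem_map).1 (hβ ▸ hz)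
    exact ⟨⟨w, hw⟩, rfl⟩
  -- Both quotients are quotients of `W` by the same subspace. This replaces a connecting
  -- homomorphism: `W` is the graph-like space on which a diagram chase takes place.
  have hk : LinearMap.ker f₁ = LinearMap.ker f₂ := by
    ext ⟨w, hw⟩
    simp only [f₁, f₂, LinearMap.mem_ker, LinearMap.comp_apply, Submodule.mkQ_apply,
      Submodule.Quotient.mk_eq_zero]
    exact h w hw
  exact ((f₁.quotKerEquivOfSurjective s₁).symm.trans ((Submodule.quotEquivOfEq _ _ hk).trans
    (f₂.quotKerEquivOfSurjective s₂))).finrank_eq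

variable {σ R M M' : Type*} [Fintype σ] [LinearOrder σ] [CommRing R]
  [AddCommGroup M] [Module R M] [AddCommGroup M'] [Module R M']

/-- The sign of removing `i` from `insert i T` in the Koszul complex. -/
def koszulSign (R : Type*) [CommRing R] (i : σ) (T : Finset σ) : R := (-1) ^ (T.filter (· < i)).card

theorem koszulSign_mul_self (i : σ) (T : Finset σ) : koszulSign R i T * koszulSign R i T = 1 := by
  rw [koszulSign, ← mul_pow]; simp

theorem koszulSign_insert {i j : σ} {T : Finset σ} (hi : i ∉ T) :
    koszulSign R j (insert i T) = (if i < j then -1 else 1) * koszulSign R j T := by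
  unfold koszulSign
  rw [Finset.filter_insert]
  split_ifs
  · rw [Finset.card_insert_of_notMem (fun h => hi (Finset.mem_filter.1 h).1), pow_succ, mul_comm]
  · rw [one_mul]

theorem koszulSign_anticomm {i j : σ} {T : Finset σ} (hi : i ∉ T) (hj : j ∉ T) (hij : i ≠ j) :
    koszulSign R i T * koszulSign R j (insert i T) =
      -(koszulSign R j T * koszulSign R i (insert j T)) := by
  rw [koszulSign_insert hi, koszulSign_insert hj]
  rcases lt_or_gt_of_ne hij with h | h
  · rw [if_pos h, if_neg h.not_gt]; ring
  · rw [if_neg h.not_gt, if_pos h]; ring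

/-- The differential of the Koszul complex of the sequence `y` with coefficients in `M`; a chain
is written as the function of its coefficients. -/
def koszulD (y : σ → R) : (Finset σ → M) →ₗ[R] (Finset σ → M) :=
  LinearMap.pi fun T => ∑ i ∈ Tᶜ, (koszulSign R i T * y i) • LinearMap.proj (insert i T)

theorem koszulD_apply (y : σ → R) (f : Finset σ → M) (T : Finset σ) :
    koszulD y f T = ∑ i ∈ Tᶜ, (koszulSign R i T * y i) • f (insert i T) := by
  simp [koszulD, LinearMap.sum_apply]

theorem koszulD_koszulD (y : σ → R) (f : Finset σ → M) : koszulD y (koszulD y f) = 0 := by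
  funext T
  simp_rw [koszulD_apply, Finset.smul_sum, smul_smul]
  rw [Finset.sum_sigma', Pi.zero_apply]
  -- Removing i then j and removing j then i contribute opposite signs, by `koszulSign_anticomm`.
  refine Finset.sum_involution (fun p _ => ⟨p.2, p.1⟩) ?_ ?_ ?_ ?_
  · rintro ⟨i, j⟩ h
    simp only [Finset.mem_sigma, Finset.mem_compl, Finset.mem_insert, not_or] at h
    obtain ⟨hi, hji, hj⟩ := h
    have := koszulSign_anticomm (R := R) hi hj (Ne.symm hji)
    rw [Finset.insert_comm j i, ← add_smul]
    convert zero_smul R _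
    linear_combination (y i * y j) * this
  · rintro ⟨i, j⟩ h _ he
    simp only [Finset.mem_sigma, Finset.mem_compl, Finset.mem_insert, not_or] at h
    simp only [Sigma.mk.injEq, heq_eq_eq] at he
    exact h.2.1 he.1
  · rintro ⟨i, j⟩ h
    simp only [Finset.mem_sigma, Finset.mem_compl, Finset.mem_insert, not_or] at h ⊢
    exact ⟨h.2.2, Ne.symm h.2.1, h.1⟩
  · rintro ⟨i, j⟩ _
    rfl

/-- The Koszul differential is natural in the coefficients. -/
theorem koszulD_map (y : σ → R) (φ : M →ₗ[R] M') (f : Finset σ → M) :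
    koszulD y (fun S => φ (f S)) = fun S => φ (koszulD y f S) := by
  funext T
  simp only [koszulD_apply, map_sum, map_smul]

theorem koszulD_eq_zero_of_card_ne (y : σ → R) {f : Finset σ → M} {p : ℕ}
    (hf : ∀ S, S.card ≠ p + 1 → f S = 0) (T : Finset σ) (hT : T.card ≠ p) : koszulD y f T = 0 := by
  rw [koszulD_apply]
  refine Finset.sum_eq_zero fun i hi => ?_
  rw [hf, smul_zero]
  rw [Finset.card_insert_of_notMem (Finset.mem_compl.1 hi)]
  omega

variable {k : Type*} [Field k] [Algebra k R] [Module k M] [IsScalarTower k R M]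
  [Module k M'] [IsScalarTower k R M']

/-- The chains of homological degree `p` whose coefficients lie in `𝒢 p`. -/
def chains (σ : Type*) (𝒢 : ℕ → Submodule k M) (p : ℕ) : Submodule k (Finset σ → M) where
  carrier := {f | ∀ S, f S ∈ 𝒢 p ∧ (S.card ≠ p → f S = 0)}
  add_mem' {f g} hf hg S := ⟨add_mem (hf S).1 (hg S).1, fun h => by
    simp [(hf S).2 h, (hg S).2 h]⟩
  zero_mem' S := ⟨zero_mem _, fun _ => rfl⟩
  smul_mem' c f hf S := ⟨Submodule.smul_mem _ _ (hf S).1, fun h => by simp [(hf S).2 h]⟩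

theorem mem_chains {𝒢 : ℕ → Submodule k M} {p : ℕ} {f : Finset σ → M} :
    f ∈ chains σ 𝒢 p ↔ ∀ S, f S ∈ 𝒢 p ∧ (S.card ≠ p → f S = 0) := Iff.rfl

/-- The Koszul cycles in `chains σ 𝒢 p`. -/
def cycles (y : σ → R) (𝒢 : ℕ → Submodule k M) (p : ℕ) : Submodule k (Finset σ → M) :=
  chains σ 𝒢 p ⊓ LinearMap.ker ((koszulD y).restrictScalars k)

/-- The Koszul boundaries of chains in `chains σ 𝒢 (p + 1)`. -/
def boundaries (y : σ → R) (𝒢 : ℕ → Submodule k M) (p : ℕ) : Submodule k (Finset σ → M) :=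
  (chains σ 𝒢 (p + 1)).map ((koszulD y).restrictScalars k)

/-- The dimension of Koszul homology with coefficients in `𝒢`. -/
noncomputable def koszulDim (y : σ → R) (𝒢 : ℕ → Submodule k M) (p : ℕ) : ℕ :=
  Module.finrank k (cycles y 𝒢 p ⧸ (boundaries y 𝒢 p).submoduleOf (cycles y 𝒢 p))

theorem mem_cycles {y : σ → R} {𝒢 : ℕ → Submodule k M} {p : ℕ} {f : Finset σ → M} :
    f ∈ cycles y 𝒢 p ↔ f ∈ chains σ 𝒢 p ∧ koszulD y f = 0 := Iff.rfl

theorem koszulD_mem_chains {y : σ → R} {𝒢 : ℕ → Submodule k M}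
    (hy : ∀ p i, ∀ v ∈ 𝒢 (p + 1), y i • v ∈ 𝒢 p) {p : ℕ} {f : Finset σ → M}
    (hf : f ∈ chains σ 𝒢 (p + 1)) : koszulD y f ∈ chains σ 𝒢 p := by
  intro T
  refine ⟨?_, koszulD_eq_zero_of_card_ne y (fun S => (hf S).2) T⟩
  rw [koszulD_apply]
  refine Submodule.sum_mem _ fun i _ => ?_
  rw [mul_smul]
  rcases neg_one_pow_eq_or R (T.filter (· < i)).card with h | h
  · rw [koszulSign, h, one_smul]; exact hy _ _ _ (hf _).1
  · rw [koszulSign, h, neg_one_smul]; exact neg_mem (hy _ _ _ (hf _).1)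

theorem boundaries_le_cycles {y : σ → R} {𝒢 : ℕ → Submodule k M}
    (hy : ∀ p i, ∀ v ∈ 𝒢 (p + 1), y i • v ∈ 𝒢 p) (p : ℕ) :
    boundaries y 𝒢 p ≤ cycles y 𝒢 p := by
  rintro f ⟨g, hg, rfl⟩
  exact ⟨koszulD_mem_chains hy hg, koszulD_koszulD y g⟩

theorem koszulDim_eq_zero {y : σ → R} {𝒢 : ℕ → Submodule k M} {p : ℕ}
    (h : cycles y 𝒢 p ≤ boundaries y 𝒢 p) : koszulDim y 𝒢 p = 0 := by
  rw [koszulDim, Submodule.submoduleOf_eq_top.2 h]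
  exact Module.finrank_zero_of_subsingleton

/-- With no chains one step up there are no boundaries. This is the situation on the linear strand.
-/
theorem koszulDim_of_chains_eq_bot {y : σ → R} {𝒢 : ℕ → Submodule k M} {p : ℕ}
    (h : 𝒢 (p + 1) = ⊥) : koszulDim y 𝒢 p = Module.finrank k (cycles y 𝒢 p) := by
  have hB : boundaries y 𝒢 p = ⊥ := by
    rw [eq_bot_iff]
    rintro _ ⟨g, hg, rfl⟩
    have : g = 0 := by
      funext S
      simpa [h] using (hg S).1
    simp [this]
  rw [koszulDim, hB]
  have : (⊥ : Submodule k (Finset σ → M)).submoduleOf (cycles y 𝒢 p) = ⊥ := by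
    simp [Submodule.submoduleOf]
  rw [this]
  exact (Submodule.quotEquivOfEqBot _ rfl).finrank_eq

theorem koszulDim_add_finrank_boundaries {y : σ → R} {𝒢 : ℕ → Submodule k M}
    (hy : ∀ p i, ∀ v ∈ 𝒢 (p + 1), y i • v ∈ 𝒢 p) (p : ℕ)
    [FiniteDimensional k (cycles y 𝒢 p)] :
    koszulDim y 𝒢 p + Module.finrank k (boundaries y 𝒢 p) = Module.finrank k (cycles y 𝒢 p) := by
  rw [koszulDim, ← (Submodule.submoduleOfEquivOfLe (boundaries_le_cycles hy p)).finrank_eq]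
  exact Submodule.finrank_quotient_add_finrank _

/-- A chain is a choice of coefficients for the subsets of cardinality `p`. -/
def chainsEquiv (𝒢 : ℕ → Submodule k M) (p : ℕ) :
    chains σ 𝒢 p ≃ₗ[k] ({S : Finset σ // S.card = p} → 𝒢 p) where
  toFun f S := ⟨f.1 S, (f.2 S).1⟩
  map_add' _ _ := rfl
  map_smul' _ _ := rfl
  invFun g := ⟨fun S => if h : S.card = p then g ⟨S, h⟩ else 0, fun S => by
    dsimp only
    constructor
    · split_ifs
      · exact (g _).2
      · exact zero_mem _
    · intro h
      rw [dif_neg h]⟩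
  left_inv f := by
    ext S
    by_cases h : S.card = p
    · simp [h]
    · simp [h, (f.2 S).2 h]
  right_inv g := by
    funext S
    ext
    simp [S.2]

theorem finrank_chains (𝒢 : ℕ → Submodule k M) (p : ℕ) [FiniteDimensional k (𝒢 p)] :
    Module.finrank k (chains σ 𝒢 p) = (Fintype.card σ).choose p * Module.finrank k (𝒢 p) := by
  rw [(chainsEquiv 𝒢 p).finrank_eq, Module.finrank_pi_fintype]
  simp

instance finiteDimensional_chains (𝒢 : ℕ → Submodule k M) (p : ℕ) [FiniteDimensional k (𝒢 p)] :
    FiniteDimensional k (chains σ 𝒢 p) :=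
  (chainsEquiv 𝒢 p).symm.finiteDimensional

instance finiteDimensional_cycles (y : σ → R) (𝒢 : ℕ → Submodule k M) (p : ℕ)
    [FiniteDimensional k (𝒢 p)] : FiniteDimensional k (cycles y 𝒢 p) :=
  Submodule.finiteDimensional_of_le (inf_le_left : _ ≤ chains σ 𝒢 p)

/-- Rank-nullity for the differential on (p+1)-chains; the source of the binomial coefficient in the
final formula. -/
theorem finrank_boundaries_add_finrank_cycles (y : σ → R) (𝒢 : ℕ → Submodule k M) (p : ℕ)
    [FiniteDimensional k (𝒢 (p + 1))] :
    Module.finrank k (boundaries y 𝒢 p) + Module.finrank k (cycles y 𝒢 (p + 1)) =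
      (Fintype.card σ).choose (p + 1) * Module.finrank k (𝒢 (p + 1)) := by
  rw [← finrank_chains (σ := σ),
    ← (((koszulD y).restrictScalars k).domRestrict
      (chains σ 𝒢 (p + 1))).finrank_range_add_finrank_ker]
  congr 1
  · rw [LinearMap.range_domRestrict]; rfl
  · rw [LinearMap.ker_domRestrict]
    have h : (cycles y 𝒢 (p + 1)).submoduleOf (chains σ 𝒢 (p + 1)) =
        (LinearMap.ker ((koszulD y).restrictScalars k)).submoduleOf (chains σ 𝒢 (p + 1)) := by
      simp [cycles, Submodule.submoduleOf]
    rw [← (Submodule.submoduleOfEquivOfLe (p := cycles y 𝒢 (p + 1))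
      (q := chains σ 𝒢 (p + 1)) inf_le_left).finrank_eq, h]
    rfl

/-! ### Dimension shifting in Koszul homology -/

section Shift

variable {y : σ → R} {φ : M →ₗ[R] M'} {ℱ 𝒩' : ℕ → Submodule k M} {𝒩 : ℕ → Submodule k M'}

theorem exists_chain_lift (hφ : ∀ p, (ℱ p).map (φ.restrictScalars k) = 𝒩 p) {p : ℕ}
    {g : Finset σ → M'} (hg : g ∈ chains σ 𝒩 p) :
    ∃ f ∈ chains σ ℱ p, (fun S => φ (f S)) = g := by
  classical
  have h : ∀ S, ∃ v ∈ ℱ p, φ v = g S := fun S => by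
    have := (hg S).1
    rw [← hφ] at this
    exact this
  choose f hf hfg using h
  refine ⟨fun S => if S.card = p then f S else 0, fun S => ⟨?_, fun h => if_neg h⟩, ?_⟩
  · show (if S.card = p then f S else 0) ∈ ℱ p
    split_ifs
    · exact hf S
    · exact zero_mem _
  · funext S
    show φ (if S.card = p then f S else 0) = g S
    split_ifs with h
    · exact hfg S
    · rw [map_zero, (hg S).2 h]

theorem map_mem_chains (hφ : ∀ p, (ℱ p).map (φ.restrictScalars k) = 𝒩 p) {p : ℕ}
    {f : Finset σ → M} (hf : f ∈ chains σ ℱ p) : (fun S => φ (f S)) ∈ chains σ 𝒩 p := by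
  refine fun S => ⟨?_, fun h => ?_⟩
  · rw [← hφ]
    exact Submodule.mem_map_of_mem (hf S).1
  · show φ (f S) = 0
    rw [(hf S).2 h, map_zero]

theorem mem_chains_ker (hker : ∀ p, 𝒩' p = ℱ p ⊓ LinearMap.ker (φ.restrictScalars k)) {p : ℕ}
    {f : Finset σ → M} :
    f ∈ chains σ 𝒩' p ↔ f ∈ chains σ ℱ p ∧ (fun S => φ (f S)) = 0 := by
  constructor
  · intro hf
    refine ⟨fun S => ⟨?_, (hf S).2⟩, funext fun S => ?_⟩
    · have := (hf S).1
      rw [hker] at this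
      exact this.1
    · have := (hf S).1
      rw [hker] at this
      exact this.2
  · rintro ⟨hf, h0⟩ S
    refine ⟨?_, (hf S).2⟩
    rw [hker]
    exact ⟨(hf S).1, congrFun h0 S⟩

/-- Dimension shifting along a short exact sequence with Koszul acyclic middle term. -/
theorem koszulDim_succ_of_exact (hy : ∀ p i, ∀ v ∈ ℱ (p + 1), y i • v ∈ ℱ p)
    (hφ : ∀ p, (ℱ p).map (φ.restrictScalars k) = 𝒩 p)
    (hker : ∀ p, 𝒩' p = ℱ p ⊓ LinearMap.ker (φ.restrictScalars k)) {p : ℕ}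
    (hF : cycles y ℱ (p + 1) ≤ boundaries y ℱ (p + 1))
    (hN : cycles y 𝒩' p ≤ boundaries y ℱ p) :
    koszulDim y 𝒩 (p + 1) = koszulDim y 𝒩' p := by
  -- The chains over the middle term whose boundary lies in the kernel: φ sends them onto the cycles
  -- of the quotient, and the differential sends them onto the cycles of the kernel.
  let W : Submodule k (Finset σ → M) :=
    chains σ ℱ (p + 1) ⊓ (chains σ 𝒩' p).comap ((koszulD y).restrictScalars k)
  let α : (Finset σ → M) →ₗ[k] (Finset σ → M') :=
    LinearMap.pi fun S => (φ.restrictScalars k).comp (LinearMap.proj S)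
  have hα : ∀ f, α f = fun S => φ (f S) := fun f => rfl
  refine finrank_quotient_eq_of_correspondence W _ _ _ _ α ((koszulD y).restrictScalars k)
    ?_ ?_ ?_
  · ext z
    constructor
    · rintro ⟨f, ⟨hf, hdf⟩, rfl⟩
      refine ⟨map_mem_chains hφ hf, ?_⟩
      show koszulD y _ = 0
      rw [hα, koszulD_map]
      exact ((mem_chains_ker hker).1 hdf).2
    · rintro ⟨hz, hdz⟩
      obtain ⟨f, hf, rfl⟩ := exists_chain_lift hφ hz
      refine ⟨f, ⟨hf, (mem_chains_ker hker).2 ⟨koszulD_mem_chains hy hf, ?_⟩⟩, rfl⟩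
      rw [LinearMap.restrictScalars_apply, ← koszulD_map]
      exact hdz
  · ext z
    constructor
    · rintro ⟨f, ⟨hf, hdf⟩, rfl⟩
      exact ⟨hdf, koszulD_koszulD y f⟩
    · intro hz
      obtain ⟨f, hf, rfl⟩ := hN hz
      exact ⟨f, ⟨hf, hz.1⟩, rfl⟩
  · rintro f ⟨hf, hdf⟩
    constructor
    · rintro ⟨g, hg, hgf⟩
      obtain ⟨g', hg', rfl⟩ := exists_chain_lift hφ hg
      -- Subtracting the boundary of the lift moves f into the kernel without changing its own
      -- boundary.
      refine ⟨f - koszulD y g', (mem_chains_ker hker).2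
        ⟨sub_mem hf (koszulD_mem_chains hy hg'), ?_⟩, ?_⟩
      · rw [LinearMap.restrictScalars_apply, koszulD_map, hα] at hgf
        funext S
        have := congrFun hgf S
        simp only [Pi.sub_apply, map_sub, Pi.zero_apply] at this ⊢
        rw [this, sub_self]
      · simp [map_sub, koszulD_koszulD]
    · rintro ⟨g, hg, hgf⟩
      have hg' := (mem_chains_ker hker).1 hg
      -- f and g have the same boundary, so f - g is a cycle of the acyclic middle term, and φ(f -
      -- g) = φ(f).
      obtain ⟨h, hh, hhf⟩ := hF (x := f - g) ⟨sub_mem hf hg'.1, by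
        show koszulD y (f - g) = 0
        rw [map_sub, sub_eq_zero]; exact hgf.symm⟩
      refine ⟨fun S => φ (h S), map_mem_chains hφ hh, ?_⟩
      rw [LinearMap.restrictScalars_apply] at hhf ⊢
      rw [koszulD_map, hhf, hα]
      funext S
      have := congrFun hg'.2 S
      simp only [Pi.sub_apply, map_sub, Pi.zero_apply] at this ⊢
      rw [this, sub_zero]

theorem cycles_zero (y : σ → R) (𝒢 : ℕ → Submodule k M) : cycles y 𝒢 0 = chains σ 𝒢 0 := by
  refine inf_eq_left.2 fun f hf => ?_
  funext T
  rw [LinearMap.restrictScalars_apply, koszulD_apply]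
  refine Finset.sum_eq_zero fun i _ => ?_
  rw [(hf _).2 (by simp), smul_zero]

/-- Koszul homology in degree zero of the image of a map whose kernel is superfluous. -/
theorem koszulDim_zero_of_exact {ι : Type*} [Fintype ι]
    (hy : ∀ p i, ∀ v ∈ ℱ (p + 1), y i • v ∈ ℱ p)
    (hφ : ∀ p, (ℱ p).map (φ.restrictScalars k) = 𝒩 p)
    (hker : ∀ p, 𝒩' p = ℱ p ⊓ LinearMap.ker (φ.restrictScalars k))
    (hN : cycles y 𝒩' 0 ≤ boundaries y ℱ 0) (θ : M →ₗ[k] (ι → k))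
    (hθ : (ℱ 0).map θ = ⊤)
    (hθB : ∀ f ∈ chains σ ℱ 0, f ∈ boundaries y ℱ 0 ↔ θ (f ∅) = 0) :
    koszulDim y 𝒩 0 = Fintype.card ι := by
  let α : (Finset σ → M) →ₗ[k] (Finset σ → M') :=
    LinearMap.pi fun S => (φ.restrictScalars k).comp (LinearMap.proj S)
  have hα : ∀ f, α f = fun S => φ (f S) := fun f => rfl
  rw [koszulDim, finrank_quotient_eq_of_correspondence (chains σ ℱ 0) _ _ ⊤ ⊥ α
    (θ.comp (LinearMap.proj ∅))]
  · have : (⊥ : Submodule k (ι → k)).submoduleOf ⊤ = ⊥ := by simp [Submodule.submoduleOf]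
    rw [this, (Submodule.quotEquivOfEqBot _ rfl).finrank_eq, finrank_top,
      Module.finrank_fintype_fun_eq_card]
  · rw [cycles_zero]
    ext z
    constructor
    · rintro ⟨f, hf, rfl⟩
      exact map_mem_chains hφ hf
    · intro hz
      obtain ⟨f, hf, rfl⟩ := exists_chain_lift hφ hz
      exact ⟨f, hf, rfl⟩
  · rw [← hθ]
    ext z
    constructor
    · rintro ⟨f, hf, rfl⟩
      exact ⟨f ∅, (hf ∅).1, rfl⟩
    · rintro ⟨v, hv, rfl⟩
      refine ⟨Pi.single ∅ v, fun S => ?_, by simp⟩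
      by_cases h : S = ∅
      · subst h; simpa using hv
      · simp [Pi.single_eq_of_ne h]
  · intro f hf
    rw [LinearMap.comp_apply, LinearMap.proj_apply, Submodule.mem_bot, ← hθB f hf]
    constructor
    · rintro ⟨g, hg, hgf⟩
      obtain ⟨g', hg', rfl⟩ := exists_chain_lift hφ hg
      -- A 0-chain of the kernel is automatically a cycle, hence by `hN` already a boundary over the
      -- middle term: the kernel adds no relations in degree zero.
      have hc : f - koszulD y g' ∈ cycles y 𝒩' 0 := by
        rw [cycles_zero]
        refine (mem_chains_ker hker).2 ⟨sub_mem hf (koszulD_mem_chains hy hg'), ?_⟩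
        rw [LinearMap.restrictScalars_apply, koszulD_map, hα] at hgf
        funext S
        have := congrFun hgf S
        simp only [Pi.sub_apply, map_sub, Pi.zero_apply] at this ⊢
        rw [this, sub_self]
      have := add_mem (hN hc) (⟨g', hg', rfl⟩ : koszulD y g' ∈ boundaries y ℱ 0)
      simpa using this
    · rintro ⟨g, hg, rfl⟩
      refine ⟨fun S => φ (g S), map_mem_chains hφ hg, ?_⟩
      rw [LinearMap.restrictScalars_apply, koszulD_map, hα]
      rfl

end Shift

end Koszul

/-! ### A contracting homotopy for multigraded pieces of the Koszul complex -/

section Homotopy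

variable {σ k : Type*} [Fintype σ] [LinearOrder σ] [Field k]

set_option linter.unusedSectionVars false

/-- The exponent of the squarefree monomial with support `T`. -/
noncomputable def squarefreeExponent (T : Finset σ) : σ →₀ ℕ := ∑ i ∈ T, Finsupp.single i 1

theorem squarefreeExponent_insert {i : σ} {T : Finset σ} (hi : i ∉ T) :
    squarefreeExponent (insert i T) = Finsupp.single i 1 + squarefreeExponent T :=
  Finset.sum_insert hi

theorem squarefreeExponent_apply (T : Finset σ) (i : σ) :
    squarefreeExponent T i = if i ∈ T then 1 else 0 := by
  simp [squarefreeExponent, Finsupp.single_apply]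

theorem degree_squarefreeExponent (T : Finset σ) : (squarefreeExponent T).degree = T.card := by
  simp [squarefreeExponent, map_sum]

theorem koszulSign_mvPolynomial (i : σ) (T : Finset σ) :
    koszulSign (MvPolynomial σ k) i T = C (koszulSign k i T) := by
  simp [koszulSign]

theorem coeff_koszulD_X (f : Finset σ → MvPolynomial σ k) (T : Finset σ) (v : σ →₀ ℕ) :
    coeff v (koszulD (X : σ → MvPolynomial σ k) f T) = ∑ j ∈ Tᶜ, if v j ≠ 0 then
      koszulSign k j T * coeff (v - Finsupp.single j 1) (f (insert j T)) else 0 := by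
  rw [koszulD_apply, coeff_sum]
  refine Finset.sum_congr rfl fun j _ => ?_
  rw [smul_eq_mul, koszulSign_mvPolynomial, mul_assoc, coeff_C_mul, coeff_X_mul']
  simp only [Finsupp.mem_support_iff]
  split_ifs <;> simp

/-- In multidegree `u`, wedge with the basis vector of index `e u` and divide by its variable. -/
noncomputable def koszulHomotopy (e : (σ →₀ ℕ) → σ) (f : Finset σ → MvPolynomial σ k)
    (T : Finset σ) : MvPolynomial σ k :=
  ∑ i ∈ T, ∑ w ∈ (f (T.erase i)).support,
    if e (w + squarefreeExponent (T.erase i)) = i ∧ w i ≠ 0 then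
      monomial (w - Finsupp.single i 1) (koszulSign k i (T.erase i) * coeff w (f (T.erase i)))
    else 0

theorem add_squarefreeExponent_erase {i : σ} {T : Finset σ} (hi : i ∈ T) (v : σ →₀ ℕ) :
    v + Finsupp.single i 1 + squarefreeExponent (T.erase i) = v + squarefreeExponent T := by
  conv_rhs => rw [← Finset.insert_erase hi, squarefreeExponent_insert (Finset.notMem_erase i T)]
  rw [add_assoc]

/-- The coefficient of x^v on T has multidegree v + T, which the homotopy preserves, so only the
index chosen for that multidegree contributes. -/
theorem coeff_koszulHomotopy (e : (σ →₀ ℕ) → σ) (f : Finset σ → MvPolynomial σ k)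
    (T : Finset σ) (v : σ →₀ ℕ) (i : σ) (hi : e (v + squarefreeExponent T) = i) :
    coeff v (koszulHomotopy e f T) = if i ∈ T then
      koszulSign k i (T.erase i) * coeff (v + Finsupp.single i 1) (f (T.erase i)) else 0 := by
  have key : ∀ j ∈ T, coeff v (∑ w ∈ (f (T.erase j)).support,
      if e (w + squarefreeExponent (T.erase j)) = j ∧ w j ≠ 0 then
        monomial (w - Finsupp.single j 1) (koszulSign k j (T.erase j) * coeff w (f (T.erase j)))
      else 0) = if j = i then
        koszulSign k j (T.erase j) * coeff (v + Finsupp.single j 1) (f (T.erase j)) else 0 := by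
    intro j hj
    rw [coeff_sum, Finset.sum_eq_single (v + Finsupp.single j 1)]
    · rw [add_squarefreeExponent_erase hj, hi]
      by_cases h : i = j
      · simp [h]
      · simp [h, Ne.symm h]
    · intro w _ hne
      split_ifs with h
      · rw [coeff_monomial, if_neg]
        rintro rfl
        refine hne (tsub_add_cancel_of_le ?_).symm
        rw [Finsupp.single_le_iff]
        exact Nat.one_le_iff_ne_zero.2 h.2
      · simp
    · intro h
      rw [notMem_support_iff.1 h]
      simp
  rw [koszulHomotopy, coeff_sum, Finset.sum_congr rfl key, Finset.sum_ite_eq']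

/-- The homotopy h satisfies dh + hd = id in every multidegree where the chosen variable occurs, so
dh(f) = f for a cycle f. -/
theorem koszulD_koszulHomotopy (e : (σ →₀ ℕ) → σ) (f : Finset σ → MvPolynomial σ k)
    (hf : koszulD (X : σ → MvPolynomial σ k) f = 0)
    (he : ∀ S, ∀ v ∈ (f S).support, (v + squarefreeExponent S) (e (v + squarefreeExponent S)) ≠ 0) :
    koszulD (X : σ → MvPolynomial σ k) (koszulHomotopy e f) = f := by
  funext T
  ext v
  rw [coeff_koszulD_X]
  generalize hi : e (v + squarefreeExponent T) = i
  have h1 : ∀ j ∈ Tᶜ, (if v j ≠ 0 then koszulSign k j T *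
        coeff (v - Finsupp.single j 1) (koszulHomotopy e f (insert j T)) else 0) =
      if v j ≠ 0 then koszulSign k j T * (if i ∈ insert j T then
        koszulSign k i ((insert j T).erase i) *
          coeff (v - Finsupp.single j 1 + Finsupp.single i 1) (f ((insert j T).erase i)) else 0)
      else 0 := by
    intro j hj
    split_ifs with hv h2
    all_goals try rfl
    all_goals
      rw [coeff_koszulHomotopy e f _ _ i]
      · simp [h2]
      · rw [squarefreeExponent_insert (Finset.mem_compl.1 hj), ← add_assoc,
          tsub_add_cancel_of_le, hi]
        rw [Finsupp.single_le_iff]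
        exact Nat.one_le_iff_ne_zero.2 hv
  rw [Finset.sum_congr rfl h1]
  -- If i ∈ T, the coefficient of f on T is recovered from the cycle relation at T \ {i}. If i ∉ T,
  -- only the summand j = i survives and it returns the coefficient directly.
  by_cases hiT : i ∈ T
  · obtain ⟨T', hiT', rfl⟩ : ∃ T', i ∉ T' ∧ insert i T' = T :=
      ⟨T.erase i, Finset.notMem_erase i T, Finset.insert_erase hiT⟩
    have h2 := congrArg (coeff (v + Finsupp.single i 1)) (congrFun hf T')
    rw [coeff_koszulD_X, Pi.zero_apply, coeff_zero] at h2
    have h3 : T'ᶜ = insert i (insert i T')ᶜ := by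
      ext x
      simp only [Finset.mem_compl, Finset.mem_insert, not_or]
      by_cases hx : x = i
      · simp [hx, hiT']
      · simp [hx]
    rw [h3, Finset.sum_insert (by simp)] at h2
    rw [if_pos (by simp), add_tsub_cancel_right] at h2
    have h4 := congrArg (fun z => koszulSign k i T' * z) (eq_neg_of_add_eq_zero_left h2)
    simp only [← mul_assoc, koszulSign_mul_self, one_mul] at h4
    rw [h4, mul_neg, Finset.mul_sum, ← Finset.sum_neg_distrib]
    refine Finset.sum_congr rfl fun j hj => ?_
    simp only [Finset.mem_compl, Finset.mem_insert, not_or] at hj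
    obtain ⟨hji, hjT⟩ := hj
    have hvj : (v + Finsupp.single i 1 : σ →₀ ℕ) j ≠ 0 ↔ v j ≠ 0 := by
      rw [Finsupp.add_apply, Finsupp.single_eq_of_ne hji, add_zero]
    by_cases hv : v j = 0
    · rw [if_neg (not_not.2 hv), if_neg (mt hvj.1 (not_not.2 hv)), mul_zero, neg_zero]
    · rw [if_pos hv, if_pos (hvj.2 hv), if_pos (by simp)]
      have h5 : (insert j (insert i T')).erase i = insert j T' := by
        rw [Finset.insert_comm, Finset.erase_insert]
        simp [hiT', Ne.symm hji]
      have h6 : v - Finsupp.single j 1 + Finsupp.single i 1 =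
          v + Finsupp.single i 1 - Finsupp.single j 1 := by
        rw [tsub_add_eq_add_tsub]
        rw [Finsupp.single_le_iff]
        exact Nat.one_le_iff_ne_zero.2 hv
      rw [h5, h6, koszulSign_insert hiT', koszulSign_insert hjT]
      rcases lt_or_gt_of_ne hji with h | h
      · rw [if_pos h, if_neg h.not_gt]; ring
      · rw [if_neg h.not_gt, if_pos h]; ring
  · rw [Finset.sum_eq_single i]
    · by_cases hv : v i = 0
      · rw [if_neg (by simpa using hv)]
        -- Here the multidegree does not involve x_i, so `he` leaves no room for a nonzero
        -- coefficient of f.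
        by_contra h0
        have := he T v (mem_support_iff.2 (Ne.symm h0))
        rw [hi, Finsupp.add_apply, hv, squarefreeExponent_apply, if_neg hiT] at this
        exact this rfl
      · have h6 : v - Finsupp.single i 1 + Finsupp.single i 1 = v := by
          rw [tsub_add_cancel_of_le]
          rw [Finsupp.single_le_iff]
          exact Nat.one_le_iff_ne_zero.2 hv
        rw [if_pos hv, if_pos (Finset.mem_insert_self _ _), Finset.erase_insert hiT, h6,
          ← mul_assoc, koszulSign_mul_self, one_mul]
    · intro j _ hji
      have : i ∉ insert j T := by simp [hiT, Ne.symm hji]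
      simp [this]
    · intro h
      exact absurd (Finset.mem_compl.2 hiT) h

/-- The monomials of the homotopy come from monomials of the chain, multiplied by the variable
chosen in their multidegree. -/
theorem exists_of_mem_support_koszulHomotopy {e : (σ →₀ ℕ) → σ} {f : Finset σ → MvPolynomial σ k}
    {T : Finset σ} {v : σ →₀ ℕ} (hv : v ∈ (koszulHomotopy e f T).support) :
    e (v + squarefreeExponent T) ∈ T ∧ v + Finsupp.single (e (v + squarefreeExponent T)) 1 ∈
      (f (T.erase (e (v + squarefreeExponent T)))).support := by
  rw [mem_support_iff, coeff_koszulHomotopy e f T v _ rfl] at hv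
  split_ifs at hv with h
  · exact ⟨h, mem_support_iff.2 (right_ne_zero_of_mul hv)⟩
  · exact absurd rfl hv

end Homotopy

/-! ### Koszul complexes of graded free modules -/

section Strands

variable {k : Type*} [Field k] {n : ℕ}

/-- Writing degrees additively makes the strand zero when c > j, where the truncated `j - c` would
wrongly allow constants. -/
theorem forall_degree_add_iff {f : CoordRing k n} {c j : ℕ} :
    (∀ u ∈ f.support, u.degree + c = j) ↔ f = 0 ∨ c ≤ j ∧ f.IsHomogeneous (j - c) := by
  constructor
  · intro h
    by_cases hf : f = 0
    · exact Or.inl hf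
    · right
      obtain ⟨u, hu⟩ := MvPolynomial.support_nonempty.2 hf
      refine ⟨by have := h u hu; omega, ?_⟩
      intro w hw
      have := h w (mem_support_iff.2 hw)
      have hw' : w.degree = j - c := by omega
      exact (DFunLike.congr_fun Finsupp.degree_eq_weight_one w).symm.trans hw'
  · rintro (rfl | ⟨hc, hf⟩) u hu
    · simp at hu
    · have : u.degree = j - c :=
        (DFunLike.congr_fun Finsupp.degree_eq_weight_one u).trans (hf (mem_support_iff.1 hu))
      omega

/-- The forms of degree `j - p` in an ideal, as coefficients of the Koszul complex. -/
def idealStrand (J : Ideal (CoordRing k n)) (j p : ℕ) : Submodule k (CoordRing k n) where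
  carrier := {f | f ∈ J ∧ ∀ u ∈ f.support, u.degree + p = j}
  add_mem' {f g} hf hg := by
    refine ⟨add_mem hf.1 hg.1, fun u hu => ?_⟩
    classical
    rcases Finset.mem_union.1 (support_add hu) with h | h
    · exact hf.2 u h
    · exact hg.2 u h
  zero_mem' := ⟨zero_mem _, by simp⟩
  smul_mem' c f hf := ⟨Submodule.smul_of_tower_mem J c hf.1, fun u hu => hf.2 u (support_smul hu)⟩

theorem mem_idealStrand {J : Ideal (CoordRing k n)} {j p : ℕ} {f : CoordRing k n} :
    f ∈ idealStrand J j p ↔ f ∈ J ∧ ∀ u ∈ f.support, u.degree + p = j := Iff.rfl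

/-- The vectors of degree `j - p` in a graded free module, as coefficients of the Koszul
complex. -/
def freeStrand {m : ℕ} (s : Fin m → ℕ) (j p : ℕ) : Submodule k (Fin m → CoordRing k n) where
  carrier := {v | ∀ b, ∀ u ∈ (v b).support, u.degree + (s b + p) = j}
  add_mem' {f g} hf hg b u hu := by
    classical
    rcases Finset.mem_union.1 (support_add hu) with h | h
    · exact hf b u h
    · exact hg b u h
  zero_mem' := by simp
  smul_mem' c f hf b u hu := hf b u (support_smul hu)

theorem degree_add_of_mul {y f : CoordRing k n} (hy : y.IsHomogeneous 1) {c j : ℕ}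
    (hf : ∀ u ∈ f.support, u.degree + (c + 1) = j) :
    ∀ u ∈ (y * f).support, u.degree + c = j := by
  rcases forall_degree_add_iff.1 hf with rfl | ⟨hc, h⟩
  · simp
  · refine forall_degree_add_iff.2 (Or.inr ⟨by omega, ?_⟩)
    have := hy.mul h
    rwa [show 1 + (j - (c + 1)) = j - c by omega] at this

theorem smul_mem_idealStrand {y : Fin (n + 1) → CoordRing k n} (hy : ∀ i, (y i).IsHomogeneous 1)
    (J : Ideal (CoordRing k n)) (j p : ℕ) (i : Fin (n + 1)) :
    ∀ f ∈ idealStrand J j (p + 1), y i • f ∈ idealStrand J j p := fun _ hf =>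
  ⟨J.mul_mem_left _ hf.1, degree_add_of_mul (hy i) hf.2⟩

theorem smul_mem_freeStrand {y : Fin (n + 1) → CoordRing k n} (hy : ∀ i, (y i).IsHomogeneous 1)
    {m : ℕ} (s : Fin m → ℕ) (j p : ℕ) (i : Fin (n + 1)) :
    ∀ v ∈ freeStrand (k := k) (n := n) s j (p + 1),
      y i • v ∈ freeStrand (k := k) (n := n) s j p := fun _ hv b =>
  degree_add_of_mul (hy i) (hv b)

/-- A linear change of coordinates. -/
def IsGradedEquiv (τ : CoordRing k n ≃ₐ[k] CoordRing k n) : Prop :=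
  ∀ (f : CoordRing k n) (m : ℕ), (τ f).IsHomogeneous m ↔ f.IsHomogeneous m

variable {τ : CoordRing k n ≃ₐ[k] CoordRing k n}

theorem IsGradedEquiv.symm (hτ : IsGradedEquiv τ) : IsGradedEquiv τ.symm := fun f m => by
  rw [← hτ, AlgEquiv.apply_symm_apply]

theorem IsGradedEquiv.isHomogeneous_X (hτ : IsGradedEquiv τ) (i : Fin (n + 1)) :
    (τ (X i)).IsHomogeneous 1 := (hτ _ _).2 (MvPolynomial.isHomogeneous_X k i)

theorem IsGradedEquiv.degree_add_iff (hτ : IsGradedEquiv τ) {f : CoordRing k n} {c j : ℕ} :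
    (∀ u ∈ (τ f).support, u.degree + c = j) ↔ ∀ u ∈ f.support, u.degree + c = j := by
  rw [forall_degree_add_iff, forall_degree_add_iff, hτ, map_eq_zero_iff _ τ.injective]

theorem koszulD_algEquiv (τ : CoordRing k n ≃ₐ[k] CoordRing k n)
    (f : Finset (Fin (n + 1)) → CoordRing k n) :
    koszulD (fun i => τ (X i)) (fun S => τ (f S)) =
      fun S => τ (koszulD (X : Fin (n + 1) → CoordRing k n) f S) := by
  funext T
  simp only [koszulD_apply, map_sum, smul_eq_mul, map_mul, koszulSign, map_pow, map_neg, map_one]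

/-- Every multidegree that occurs has total degree j - c > 0, so it involves some variable and the
homotopy for that variable applies. -/
theorem exists_koszulD_X_eq {p c j : ℕ} (hc : c < j) {f : Finset (Fin (n + 1)) → CoordRing k n}
    (hf : koszulD (X : Fin (n + 1) → CoordRing k n) f = 0)
    (hcard : ∀ S, S.card ≠ p → f S = 0)
    (hdeg : ∀ S, ∀ u ∈ (f S).support, u.degree + (c + p) = j) :
    ∃ g : Finset (Fin (n + 1)) → CoordRing k n,
      koszulD (X : Fin (n + 1) → CoordRing k n) g = f ∧ (∀ S, S.card ≠ p + 1 → g S = 0) ∧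
      ∀ S, ∀ u ∈ (g S).support, u.degree + (c + (p + 1)) = j := by
  have hex : ∀ u : Fin (n + 1) →₀ ℕ, ∃ i, u ≠ 0 → u i ≠ 0 := by
    intro u
    by_cases hu : u = 0
    · exact ⟨0, fun h => absurd hu h⟩
    · obtain ⟨i, hi⟩ := Finsupp.ne_iff.1 hu
      exact ⟨i, fun _ => hi⟩
  choose e he using hex
  have hcard' : ∀ S, ∀ v ∈ (f S).support, S.card = p := fun S v hv => by
    by_contra h
    simp [hcard S h] at hv
  refine ⟨koszulHomotopy e f, koszulD_koszulHomotopy e f hf ?_, ?_, ?_⟩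
  · intro S v hv
    refine he _ fun h0 => ?_
    have h1 := congrArg Finsupp.degree h0
    rw [map_add, degree_squarefreeExponent, map_zero, hcard' S v hv] at h1
    have := hdeg S v hv
    omega
  · intro S hS
    rw [← MvPolynomial.support_eq_empty, Finset.eq_empty_iff_forall_notMem]
    intro v hv
    obtain ⟨h1, h2⟩ := exists_of_mem_support_koszulHomotopy hv
    have h3 := hcard' _ _ h2
    have := Finset.card_erase_add_one h1
    omega
  · intro S v hv
    obtain ⟨h1, h2⟩ := exists_of_mem_support_koszulHomotopy hv
    have h3 := hdeg _ _ h2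
    rw [map_add, Finsupp.degree_single] at h3
    omega

theorem exists_koszulD_eq (hτ : IsGradedEquiv τ) {p c j : ℕ} (hc : c < j)
    {f : Finset (Fin (n + 1)) → CoordRing k n}
    (hf : koszulD (fun i => τ (X i)) f = 0)
    (hcard : ∀ S, S.card ≠ p → f S = 0)
    (hdeg : ∀ S, ∀ u ∈ (f S).support, u.degree + (c + p) = j) :
    ∃ g : Finset (Fin (n + 1)) → CoordRing k n,
      koszulD (fun i => τ (X i)) g = f ∧ (∀ S, S.card ≠ p + 1 → g S = 0) ∧
      ∀ S, ∀ u ∈ (g S).support, u.degree + (c + (p + 1)) = j := by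
  have hf' : f = fun S => τ (τ.symm (f S)) := by simp
  obtain ⟨g, hg, hg1, hg2⟩ := exists_koszulD_X_eq hc (f := fun S => τ.symm (f S)) (p := p)
    (by
      rw [hf', koszulD_algEquiv] at hf
      funext S
      have := congrFun hf S
      exact τ.injective (by rw [this]; simp))
    (fun S hS => by simp [hcard S hS]) (fun S => hτ.symm.degree_add_iff.2 (hdeg S))
  refine ⟨fun S => τ (g S), ?_, fun S hS => by simp [hg1 S hS],
    fun S => hτ.degree_add_iff.2 (hg2 S)⟩
  rw [koszulD_algEquiv, hg, ← hf']

theorem koszulD_pi_apply {m : ℕ} (y : Fin (n + 1) → CoordRing k n)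
    (f : Finset (Fin (n + 1)) → Fin m → CoordRing k n) (S : Finset (Fin (n + 1))) (b : Fin m) :
    koszulD y f S b = koszulD y (fun T => f T b) S :=
  (congrFun (koszulD_map y (LinearMap.proj b) f) S).symm

/-- The Koszul complex of a graded free module is acyclic. -/
theorem mem_boundaries_freeStrand (hτ : IsGradedEquiv τ) {m : ℕ} {s : Fin m → ℕ} {j p : ℕ}
    {z : Finset (Fin (n + 1)) → Fin m → CoordRing k n}
    (hz : z ∈ cycles (fun i => τ (X i)) (freeStrand s j) p)
    (h0 : p = 0 → ∀ b, coeff 0 (z ∅ b) = 0) :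
    z ∈ boundaries (fun i => τ (X i)) (freeStrand s j) p := by
  have key : ∀ b, ∃ g : Finset (Fin (n + 1)) → CoordRing k n,
      koszulD (fun i => τ (X i)) g = (fun S => z S b) ∧ (∀ S, S.card ≠ p + 1 → g S = 0) ∧
      ∀ S, ∀ u ∈ (g S).support, u.degree + (s b + (p + 1)) = j := by
    intro b
    by_cases hb : s b < j
    · refine exists_koszulD_eq hτ hb ?_ ?_ ?_
      · funext S
        rw [← koszulD_pi_apply, (mem_cycles.1 hz).2]
        rfl
      · intro S hS
        rw [(hz.1 S).2 hS]
        rfl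
      · intro S
        exact (hz.1 S).1 b
    -- When s b ≥ j only constants with p = 0 and s b = j could occur, and `h0` excludes them.
    · refine ⟨0, ?_, fun _ _ => rfl, by simp⟩
      rw [map_zero]
      funext S
      by_cases hS : S.card = p
      · by_contra hne
        obtain ⟨u, hu⟩ := MvPolynomial.support_nonempty.2 (Ne.symm hne)
        have h1 := (hz.1 S).1 b u hu
        have h2 : p = 0 := by omega
        have h3 : S = ∅ := by rw [← Finset.card_eq_zero, hS, h2]
        have h4 : u = 0 := (Finsupp.degree_eq_zero_iff u).1 (by omega)
        subst h3 h4
        exact (mem_support_iff.1 hu) (h0 h2 b)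
      · rw [(hz.1 S).2 hS]
        rfl
  choose g hg hg1 hg2 using key
  refine ⟨fun S b => g b S, fun S => ⟨fun b => hg2 b S, fun hS => funext fun b => hg1 b S hS⟩, ?_⟩
  funext S b
  rw [LinearMap.restrictScalars_apply, koszulD_pi_apply, hg]

/-- The constant terms at the basis elements of degree `j`. -/
noncomputable def constantTerms (k : Type*) [Field k] (n : ℕ) {m : ℕ} (s : Fin m → ℕ) (j : ℕ) :
    (Fin m → CoordRing k n) →ₗ[k] ({b // s b = j} → k) :=
  LinearMap.pi fun b => (lcoeff k 0).comp (LinearMap.proj b.1)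

theorem constantTerms_apply {m : ℕ} (s : Fin m → ℕ) (j : ℕ) (v : Fin m → CoordRing k n)
    (b : {b // s b = j}) : constantTerms k n s j v b = coeff 0 (v b) := rfl

theorem map_constantTerms {m : ℕ} (s : Fin m → ℕ) (j : ℕ) :
    (freeStrand s j 0).map (constantTerms k n s j) = ⊤ := by
  rw [eq_top_iff]
  intro w _
  refine ⟨fun b => if h : s b = j then C (w ⟨b, h⟩) else 0, fun b u hu => ?_, ?_⟩
  · dsimp only at hu
    split_ifs at hu with h
    · rw [mem_support_iff, coeff_C] at hu
      split_ifs at hu with h0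
      · rw [← h0, map_zero, h]; omega
      · exact absurd rfl hu
    · simp at hu
  · funext b
    rw [constantTerms_apply, dif_pos b.2, coeff_C, if_pos rfl]

/-- Degree-zero boundaries fill out 𝔪F, and in degree j the quotient F/𝔪F has as coordinates the
constant terms at the generators of degree j. -/
theorem mem_boundaries_freeStrand_zero_iff (hτ : IsGradedEquiv τ) {m : ℕ} {s : Fin m → ℕ} {j : ℕ}
    {f : Finset (Fin (n + 1)) → Fin m → CoordRing k n}
    (hf : f ∈ chains (Fin (n + 1)) (freeStrand s j) 0) :
    f ∈ boundaries (fun i => τ (X i)) (freeStrand s j) 0 ↔ constantTerms k n s j (f ∅) = 0 := by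
  constructor
  · rintro ⟨g, -, rfl⟩
    funext b
    rw [constantTerms_apply, LinearMap.restrictScalars_apply, koszulD_pi_apply, koszulD_apply,
      coeff_sum]
    refine Finset.sum_eq_zero fun i _ => ?_
    have : coeff 0 (τ (X i)) = 0 := (hτ.isHomogeneous_X i).coeff_eq_zero (by simp)
    rw [smul_eq_mul, ← constantCoeff_eq, map_mul, map_mul, constantCoeff_eq, this]
    simp
  · intro h
    refine mem_boundaries_freeStrand hτ (by rwa [cycles_zero]) fun _ b => ?_
    by_cases hb : s b = j
    · exact congrFun h ⟨b, hb⟩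
    · by_contra h0
      have := (hf ∅).1 b 0 (mem_support_iff.2 h0)
      rw [map_zero] at this
      omega

end Strands

/-! ### Graded Betti numbers as dimensions of Koszul homology -/

section Resolution

variable {k : Type*} [Field k] {n : ℕ}

theorem mem_freeStrand_iff {m : ℕ} {s : Fin m → ℕ} {j p : ℕ} {v : Fin m → CoordRing k n} :
    v ∈ freeStrand s j p ↔ v = 0 ∨ p ≤ j ∧ IsHomogeneousVec s (j - p) v := by
  constructor
  · intro h
    by_cases hp : p ≤ j
    · refine Or.inr ⟨hp, fun b u hu => ?_⟩
      have := h b u hu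
      omega
    · left
      funext b
      rw [Pi.zero_apply, ← MvPolynomial.support_eq_empty, Finset.eq_empty_iff_forall_notMem]
      intro u hu
      have := h b u hu
      omega
  · rintro (rfl | ⟨hp, h⟩)
    · exact zero_mem _
    · intro b u hu
      have := h b u hu
      omega

/-- A degree-preserving map commutes with the projections to graded pieces, so a homogeneous vector
in the range has a preimage of the same degree. -/
theorem map_freeStrand {m m' : ℕ} {s : Fin m → ℕ} {s' : Fin m' → ℕ}
    (φ : (Fin m' → CoordRing k n) →ₗ[CoordRing k n] (Fin m → CoordRing k n))
    (hφ : ∀ b, IsHomogeneousVec s (s' b) (φ (Pi.single b 1))) (j p : ℕ) :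
    (freeStrand s' j p).map (φ.restrictScalars k) =
      freeStrand s j p ⊓ (LinearMap.range φ).restrictScalars k := by
  ext w
  constructor
  · rintro ⟨v, hv, rfl⟩
    refine ⟨?_, v, rfl⟩
    rcases mem_freeStrand_iff.1 hv with rfl | ⟨hp, h⟩
    · rw [map_zero]; exact zero_mem _
    · refine mem_freeStrand_iff.2 (Or.inr ⟨hp, ?_⟩)
      have h1 := map_vecComponent φ hφ (j - p) v
      rw [vecComponent_of_homogeneous h, if_pos rfl] at h1
      rw [LinearMap.restrictScalars_apply, h1]
      exact isHomogeneousVec_vecComponent _ _ _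
  · rintro ⟨hw, v, rfl⟩
    rcases mem_freeStrand_iff.1 hw with h0 | ⟨hp, h⟩
    · rw [h0]; exact zero_mem _
    · refine ⟨vecComponent s' (j - p) v,
        mem_freeStrand_iff.2 (Or.inr ⟨hp, isHomogeneousVec_vecComponent _ _ _⟩), ?_⟩
      rw [LinearMap.restrictScalars_apply, map_vecComponent φ hφ,
        vecComponent_of_homogeneous h, if_pos rfl]

namespace MinimalGradedFreeResolution

variable {J : Ideal (CoordRing k n)} (F : MinimalGradedFreeResolution J)

theorem coeff_zero_diff (i : ℕ) (v : Fin (F.rank (i + 1)) → CoordRing k n) (c : Fin (F.rank i)) :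
    coeff 0 (F.diff i v c) = 0 := by
  rw [← mem_idealOfVars_iff]
  rw [← LinearMap.sum_single_apply (φ := fun _ => CoordRing k n) v, map_sum, Finset.sum_apply]
  refine Ideal.sum_mem _ fun b _ => ?_
  have : (Pi.single b (v b) : Fin (F.rank (i + 1)) → CoordRing k n) = v b • Pi.single b 1 := by
    rw [← Pi.single_smul]; simp
  rw [this, map_smul]
  exact Ideal.mul_mem_left _ _ (F.minimal i b c)

/-- Minimality forces F₀ = R with the augmentation a nonzero scalar times the quotient map. Some
generator must map to a unit modulo J in order to reach 1. -/
theorem exists_basis_zero (hJ : ∀ f ∈ J, coeff 0 f = 0) :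
    ∃ b₀ : Fin (F.rank 0), (∀ b, b = b₀) ∧ F.shift 0 b₀ = 0 ∧ ∀ v, F.aug v = 0 ↔ v b₀ ∈ J := by
  choose q hq hqaug using F.aug_homogeneous
  have haug : ∀ v, F.aug v = Ideal.Quotient.mk J (∑ b, v b * q b) := by
    intro v
    conv_lhs => rw [← LinearMap.sum_single_apply (φ := fun _ => CoordRing k n) v]
    rw [map_sum, map_sum]
    refine Finset.sum_congr rfl fun b _ => ?_
    have : (Pi.single b (v b) : Fin (F.rank 0) → CoordRing k n) = v b • Pi.single b 1 := by
      rw [← Pi.single_smul]; simp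
    rw [this, map_smul, hqaug, map_mul]
    rfl
  obtain ⟨v, hv⟩ := F.aug_surjective 1
  rw [haug, ← map_one (Ideal.Quotient.mk J), Ideal.Quotient.eq] at hv
  have h1 := hJ _ hv
  rw [← constantCoeff_eq, map_sub, map_one, sub_eq_zero, map_sum] at h1
  obtain ⟨b₀, -, hb₀⟩ := Finset.exists_ne_zero_of_sum_ne_zero (h1.trans_ne one_ne_zero)
  rw [map_mul] at hb₀
  have hq0 : coeff 0 (q b₀) ≠ 0 := right_ne_zero_of_mul hb₀
  have hs : F.shift 0 b₀ = 0 := by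
    by_contra h
    exact hq0 ((hq b₀).coeff_eq_zero (by simpa using Ne.symm h))
  have hqC : q b₀ = C (coeff 0 (q b₀)) := by
    have := hq b₀
    rw [hs] at this
    rw [← homogeneousComponent_zero, homogeneousComponent_eq_self this]
  have huniq : ∀ b, b = b₀ := by
    intro b
    by_contra hb
    -- A second generator would give this element of ker(aug) = im(diff 0), with entry 1 at b,
    -- against minimality.
    let w : Fin (F.rank 0) → CoordRing k n :=
      Pi.single b 1 - Pi.single b₀ (C (coeff 0 (q b₀))⁻¹ * q b)
    have hw : w ∈ LinearMap.ker F.aug := by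
      have h2 : (Pi.single b₀ (C (coeff 0 (q b₀))⁻¹ * q b) : Fin (F.rank 0) → CoordRing k n) =
          (C (coeff 0 (q b₀))⁻¹ * q b) • Pi.single b₀ 1 := by
        rw [← Pi.single_smul]; simp
      rw [LinearMap.mem_ker, map_sub, h2, map_smul, hqaug, hqaug, sub_eq_zero,
        ← Ideal.Quotient.mk_eq_mk, ← Ideal.Quotient.mk_eq_mk, ← Submodule.Quotient.mk_smul,
        smul_eq_mul, mul_right_comm]
      conv_rhs => rw [hqC]
      rw [coeff_C, if_pos rfl, ← C_mul, inv_mul_cancel₀ hq0, C_1, one_mul]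
    rw [F.exact_zero] at hw
    obtain ⟨x, hx⟩ := hw
    have h3 := F.coeff_zero_diff 0 x b
    rw [hx] at h3
    simp [w, Pi.single_eq_of_ne hb] at h3
  refine ⟨b₀, huniq, hs, fun v => ?_⟩
  have hsum : ∑ b, v b * q b = v b₀ * q b₀ :=
    Finset.sum_eq_single b₀ (fun b _ hb => absurd (huniq b) hb) (by simp)
  rw [haug, Ideal.Quotient.eq_zero_iff_mem, hsum, hqC, mul_comm]
  exact Ideal.unit_mul_mem_iff_mem J ((isUnit_iff_ne_zero.2 hq0).map C)

theorem gradedBetti_zero (hJ : ∀ f ∈ J, coeff 0 f = 0) (d : ℕ) :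
    F.gradedBetti 0 d = if d = 0 then 1 else 0 := by
  obtain ⟨b₀, hb, hs, -⟩ := F.exists_basis_zero hJ
  have huniv : (Finset.univ : Finset (Fin (F.rank 0))) = {b₀} := by
    ext b; simp [hb b]
  rw [gradedBetti, huniv, Finset.filter_singleton, hs]
  by_cases hd : d = 0
  · simp [hd]
  · simp [hd, Ne.symm hd]

/-- The strands of the modules of cycles. -/
noncomputable def syzygyStrand (i j p : ℕ) : Submodule k (Fin (F.rank (i + 1)) → CoordRing k n) :=
  freeStrand (F.shift (i + 1)) j p ⊓ LinearMap.ker ((F.diff i).restrictScalars k)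

variable {τ : CoordRing k n ≃ₐ[k] CoordRing k n}

/-- Minimality puts the syzygies inside 𝔪F, so their cycles bound in F even for p = 0. -/
theorem cycles_syzygyStrand_le (hτ : IsGradedEquiv τ) (i j p : ℕ) :
    cycles (fun a => τ (X a)) (F.syzygyStrand i j) p ≤
      boundaries (fun a => τ (X a)) (freeStrand (F.shift (i + 1)) j) p := by
  intro z hz
  refine mem_boundaries_freeStrand hτ ⟨fun S => ⟨((hz.1 S).1).1, (hz.1 S).2⟩, hz.2⟩ fun _ b => ?_
  have h : z ∅ ∈ LinearMap.ker (F.diff i) := ((hz.1 ∅).1).2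
  rw [F.exact_succ] at h
  obtain ⟨x, hx⟩ := h
  rw [← hx]
  exact F.coeff_zero_diff _ _ _

theorem cycles_freeStrand_le (hτ : IsGradedEquiv τ) {m : ℕ} (s : Fin m → ℕ) (j p : ℕ) :
    cycles (fun a => τ (X a)) (freeStrand (k := k) (n := n) s j) (p + 1) ≤
      boundaries (fun a => τ (X a)) (freeStrand s j) (p + 1) := fun _ hz =>
  mem_boundaries_freeStrand hτ hz fun h => absurd h (Nat.succ_ne_zero p)

theorem map_diff_succ (i j p : ℕ) :
    (freeStrand (F.shift (i + 2)) j p).map ((F.diff (i + 1)).restrictScalars k) =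
      F.syzygyStrand i j p := by
  rw [map_freeStrand _ (F.diff_homogeneous (i + 1)), ← F.exact_succ]
  rfl

theorem map_diff_zero {b₀ : Fin (F.rank 0)} (hb : ∀ b, b = b₀) (hs : F.shift 0 b₀ = 0)
    (haug : ∀ v, F.aug v = 0 ↔ v b₀ ∈ J) (j p : ℕ) :
    (freeStrand (F.shift 1) j p).map
      (((LinearMap.proj b₀).comp (F.diff 0)).restrictScalars k) = idealStrand J j p := by
  have h1 := map_freeStrand _ (F.diff_homogeneous 0) j p
  rw [← F.exact_zero] at h1
  ext f
  constructor
  · rintro ⟨v, hv, rfl⟩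
    have h2 : F.diff 0 v ∈ freeStrand (F.shift 0) j p ⊓
        (LinearMap.ker F.aug).restrictScalars k := by
      rw [← h1]
      exact ⟨v, hv, rfl⟩
    refine ⟨(haug _).1 h2.2, fun u hu => ?_⟩
    have := h2.1 b₀ u hu
    rwa [hs, zero_add] at this
  · rintro ⟨hf, hdeg⟩
    have h2 : (fun _ => f) ∈ freeStrand (F.shift 0) j p ⊓
        (LinearMap.ker F.aug).restrictScalars k := by
      refine ⟨fun b u hu => ?_, (haug _).2 hf⟩
      rw [hb b, hs, zero_add]
      exact hdeg u hu
    rw [← h1] at h2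
    obtain ⟨v, hv, hvf⟩ := h2
    exact ⟨v, hv, congrFun hvf b₀⟩

/-- The kernel of `diff i` is covered by F_{i+2} with kernel the next syzygy module. Each shift
trades one homological degree for one step along the resolution, until degree zero counts
generators. -/
theorem koszulDim_syzygyStrand (hτ : IsGradedEquiv τ) (j q : ℕ) : ∀ i,
    koszulDim (fun a => τ (X a)) (F.syzygyStrand i j) q = F.gradedBetti (i + q + 2) j := by
  induction q with
  | zero =>
    intro i
    rw [koszulDim_zero_of_exact (smul_mem_freeStrand hτ.isHomogeneous_X _ j)
      (F.map_diff_succ i j) (𝒩' := F.syzygyStrand (i + 1) j) (fun _ => rfl)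
      (F.cycles_syzygyStrand_le hτ _ _ _) (constantTerms k n (F.shift (i + 2)) j)
      (map_constantTerms _ _) (fun f hf => mem_boundaries_freeStrand_zero_iff hτ hf),
      Fintype.card_subtype]
    rfl
  | succ q ih =>
    intro i
    rw [koszulDim_succ_of_exact (smul_mem_freeStrand hτ.isHomogeneous_X _ j)
      (F.map_diff_succ i j) (𝒩' := F.syzygyStrand (i + 1) j) (fun _ => rfl)
      (cycles_freeStrand_le hτ _ _ _) (F.cycles_syzygyStrand_le hτ _ _ _), ih]
    congr 1
    omega

/-- The graded Betti numbers of `R/J` are the dimensions of Koszul homology of `J`. -/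
theorem gradedBetti_succ (hτ : IsGradedEquiv τ) (hJ : ∀ f ∈ J, coeff 0 f = 0) (q j : ℕ) :
    F.gradedBetti (q + 1) j = koszulDim (fun a => τ (X a)) (idealStrand J j) q := by
  obtain ⟨b₀, hb, hs, haug⟩ := F.exists_basis_zero hJ
  have hker : ∀ p, F.syzygyStrand 0 j p = freeStrand (F.shift 1) j p ⊓
      LinearMap.ker (((LinearMap.proj b₀).comp (F.diff 0)).restrictScalars k) := by
    intro p
    have : LinearMap.ker ((F.diff 0).restrictScalars k) =
        LinearMap.ker (((LinearMap.proj b₀).comp (F.diff 0)).restrictScalars k) := by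
      ext v
      constructor
      · intro hv
        exact congrFun hv b₀
      · intro hv
        funext b
        rw [hb b]
        exact hv
    rw [syzygyStrand, this]
  cases q with
  | zero =>
    rw [koszulDim_zero_of_exact (smul_mem_freeStrand hτ.isHomogeneous_X _ j)
      (F.map_diff_zero hb hs haug j) hker
      (F.cycles_syzygyStrand_le hτ _ _ _) (constantTerms k n (F.shift 1) j)
      (map_constantTerms _ _) (fun f hf => mem_boundaries_freeStrand_zero_iff hτ hf),
      Fintype.card_subtype]
    rfl
  | succ q =>
    rw [koszulDim_succ_of_exact (smul_mem_freeStrand hτ.isHomogeneous_X _ j)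
      (F.map_diff_zero hb hs haug j) hker
      (cycles_freeStrand_le hτ _ _ _) (F.cycles_syzygyStrand_le hτ _ _ _),
      F.koszulDim_syzygyStrand hτ, zero_add]

/-- If the `i`-th module of the resolution is generated in one degree, its rank is a graded Betti
number. -/
theorem betti_eq_gradedBetti {i j : ℕ} (h : ∀ j', j' ≠ j → F.gradedBetti i j' = 0) :
    F.betti i = F.gradedBetti i j := by
  have hall : ∀ b, F.shift i b = j := by
    intro b
    by_contra hb
    have := h _ hb
    rw [gradedBetti, Finset.card_eq_zero, Finset.eq_empty_iff_forall_notMem] at this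
    exact this b (by simp)
  rw [gradedBetti, Finset.filter_true_of_mem fun b _ => hall b, Finset.card_univ, Fintype.card_fin]
  rfl

end MinimalGradedFreeResolution

end Resolution

/-! ### Linear changes of coordinates -/

section LinearSubstitution

variable {k : Type*} [Field k] {n : ℕ}

/-- Composition of polynomials with a linear endomorphism of affine space. -/
noncomputable def linearSubst (L : (Fin (n + 1) → k) →ₗ[k] (Fin (n + 1) → k)) :
    CoordRing k n →ₐ[k] CoordRing k n :=
  aeval fun j => ∑ l, C (L (Pi.single l 1) j) * X l

theorem linearSubst_X (L : (Fin (n + 1) → k) →ₗ[k] (Fin (n + 1) → k)) (j : Fin (n + 1)) :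
    linearSubst L (X j) = ∑ l, C (L (Pi.single l 1) j) * X l := by
  rw [linearSubst, aeval_X]

theorem linear_apply_eq_sum (L : (Fin (n + 1) → k) →ₗ[k] (Fin (n + 1) → k)) (z : Fin (n + 1) → k)
    (j : Fin (n + 1)) : L z j = ∑ l, L (Pi.single l 1) j * z l := by
  conv_lhs => rw [← LinearMap.sum_single_apply (φ := fun _ => k) z, map_sum, Finset.sum_apply]
  refine Finset.sum_congr rfl fun l _ => ?_
  have : (Pi.single l (z l) : Fin (n + 1) → k) = z l • Pi.single l 1 := by
    rw [← Pi.single_smul]; simp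
  rw [this, map_smul, Pi.smul_apply, smul_eq_mul, mul_comm]

theorem eval_linearSubst (L : (Fin (n + 1) → k) →ₗ[k] (Fin (n + 1) → k)) (z : Fin (n + 1) → k)
    (f : CoordRing k n) : eval z (linearSubst L f) = eval (L z) f := by
  have : ((aeval z : CoordRing k n →ₐ[k] k).comp (linearSubst L)) = aeval (L z) := by
    ext j
    rw [AlgHom.comp_apply, linearSubst_X, aeval_X, map_sum, linear_apply_eq_sum L z j]
    simp
  exact DFunLike.congr_fun this f

theorem linearSubst_comp (L M : (Fin (n + 1) → k) →ₗ[k] (Fin (n + 1) → k)) :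
    (linearSubst L).comp (linearSubst M) = linearSubst (M ∘ₗ L) := by
  ext1 j
  rw [AlgHom.comp_apply, linearSubst_X, linearSubst_X, map_sum]
  simp_rw [map_mul, algHom_C, linearSubst_X, LinearMap.comp_apply]
  simp_rw [Finset.mul_sum]
  rw [Finset.sum_comm]
  refine Finset.sum_congr rfl fun t _ => ?_
  rw [linear_apply_eq_sum M, map_sum, Finset.sum_mul]
  refine Finset.sum_congr rfl fun l _ => ?_
  rw [map_mul, algebraMap_eq, mul_assoc]

theorem linearSubst_id : linearSubst (LinearMap.id : (Fin (n + 1) → k) →ₗ[k] _) = AlgHom.id _ _ := by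
  ext1 j
  rw [linearSubst_X, Finset.sum_eq_single j]
  · simp
  · intro l _ hl
    simp [Pi.single_eq_of_ne (Ne.symm hl)]
  · simp

/-- The automorphism of the coordinate ring given by a linear automorphism of affine space. -/
noncomputable def linearSubstEquiv (L : (Fin (n + 1) → k) ≃ₗ[k] (Fin (n + 1) → k)) :
    CoordRing k n ≃ₐ[k] CoordRing k n :=
  AlgEquiv.ofAlgHom (linearSubst L) (linearSubst L.symm)
    (by rw [linearSubst_comp, LinearEquiv.symm_comp, linearSubst_id])
    (by rw [linearSubst_comp, LinearEquiv.comp_symm, linearSubst_id])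

theorem isHomogeneous_linearSubst (L : (Fin (n + 1) → k) →ₗ[k] (Fin (n + 1) → k))
    {f : CoordRing k n} {m : ℕ} (hf : f.IsHomogeneous m) : (linearSubst L f).IsHomogeneous m := by
  have := hf.aeval (fun j => ∑ l, C (L (Pi.single l 1) j) * X l : Fin (n + 1) → CoordRing k n)
    (n := 1) fun j => IsHomogeneous.sum _ _ _ fun l _ => isHomogeneous_C_mul_X _ _
  rwa [one_mul] at this

theorem isGradedEquiv_linearSubstEquiv (L : (Fin (n + 1) → k) ≃ₗ[k] (Fin (n + 1) → k)) :
    IsGradedEquiv (linearSubstEquiv L) := by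
  refine fun f m => ⟨fun h => ?_, fun h => isHomogeneous_linearSubst _ h⟩
  have := isHomogeneous_linearSubst (L.symm : (Fin (n + 1) → k) →ₗ[k] (Fin (n + 1) → k)) h
  have h2 : linearSubst (L.symm : (Fin (n + 1) → k) →ₗ[k] (Fin (n + 1) → k)) (linearSubstEquiv L f)
      = f := (linearSubstEquiv L).symm_apply_apply f
  rwa [h2] at this

theorem exists_linearEquiv_apply_eq {ι V : Type*} [Finite ι] [AddCommGroup V] [Module k V]
    [FiniteDimensional k V] {v w : ι → V}
    (hv : LinearIndependent k v) (hw : LinearIndependent k w) :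
    ∃ L : V ≃ₗ[k] V, ∀ i, L (v i) = w i := by
  let f := hv.linearCombinationEquiv.symm ≪≫ₗ hw.linearCombinationEquiv
  obtain ⟨L, hL⟩ := Submodule.exists_linearEquiv_restrict_eq f
  refine ⟨L, fun i => ?_⟩
  have h1 : (hv.linearCombinationEquiv (Finsupp.single i 1) : V) = v i := by simp
  rw [← h1, ← hL]
  simp [f]

end LinearSubstitution

/-! ### Fat points in coordinate position -/

section Monomial

variable {k : Type*} [Field k] {n : ℕ}

/-- The ideal of the coordinate point of index `c`. -/
noncomputable def coordIdeal (k : Type*) [Field k] {n : ℕ} (c : Fin (n + 1)) : Ideal (CoordRing k n) :=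
  Ideal.span {f | (∃ m : ℕ, f.IsHomogeneous m) ∧ eval (Pi.single c 1) f = 0}

/-- The polynomials that vanish to order `a` at the coordinate point of index `c`. -/
noncomputable def vanishingIdeal (k : Type*) [Field k] {n : ℕ} (c : Fin (n + 1)) (a : ℕ) :
    Ideal (CoordRing k n) :=
  restrictSupportIdeal (R := k) (s := {v : Fin (n + 1) →₀ ℕ | v c + a ≤ v.degree}) <| by
    intro v w hvw (hv : v c + a ≤ v.degree)
    obtain ⟨x, rfl⟩ := exists_add_of_le hvw
    have := Finsupp.le_degree c x
    show (v + x) c + a ≤ (v + x).degree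
    rw [Finsupp.add_apply, map_add]
    omega

theorem mem_vanishingIdeal {c : Fin (n + 1)} {a : ℕ} {f : CoordRing k n} :
    f ∈ vanishingIdeal k c a ↔ ∀ v ∈ f.support, v c + a ≤ v.degree := Iff.rfl

/-- At the coordinate point every monomial vanishes except the powers of x_c, and a form contains at
most one of these; its coefficient is the value of the form. -/
theorem coordIdeal_le (c : Fin (n + 1)) : coordIdeal k c ≤ vanishingIdeal k c 1 := by
  refine Ideal.span_le.2 ?_
  rintro f ⟨⟨m, hm⟩, h0⟩
  refine mem_vanishingIdeal.2 fun v hv => ?_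
  by_contra hlt
  have hpure : ∀ w : Fin (n + 1) →₀ ℕ, w ≠ Finsupp.single c (w c) →
      ∏ i, (Pi.single c 1 : Fin (n + 1) → k) i ^ w i = 0 := by
    intro w hw
    obtain ⟨i, hi⟩ := Finsupp.ne_iff.1 hw
    have hic : i ≠ c := by
      rintro rfl
      simp at hi
    rw [Finsupp.single_eq_of_ne hic] at hi
    refine Finset.prod_eq_zero (Finset.mem_univ i) ?_
    rw [Pi.single_eq_of_ne hic, zero_pow hi]
  have hdeg : v.degree = v c + ∑ i ∈ Finset.univ.erase c, v i := by
    rw [Finsupp.degree_eq_sum, Finset.add_sum_erase _ _ (Finset.mem_univ c)]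
  have hvc : v = Finsupp.single c (v c) := by
    ext i
    by_cases hi : i = c
    · rw [hi, Finsupp.single_eq_same]
    · rw [Finsupp.single_eq_of_ne hi]
      have := Finset.single_le_sum (f := fun i => v i) (fun _ _ => Nat.zero_le _)
        (Finset.mem_erase.2 ⟨hi, Finset.mem_univ i⟩)
      omega
  refine mem_support_iff.1 hv ?_
  rw [eval_eq', Finset.sum_eq_single v] at h0
  · have : ∏ i, (Pi.single c 1 : Fin (n + 1) → k) i ^ v i = 1 := by
      refine Finset.prod_eq_one fun i _ => ?_
      by_cases hi : i = c
      · rw [hi, Pi.single_eq_same, one_pow]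
      · rw [hvc, Finsupp.single_eq_of_ne hi, pow_zero]
    rwa [this, mul_one] at h0
  · intro w hw hwv
    rw [hpure w, mul_zero]
    intro hwc
    refine hwv ?_
    have h1 : w.degree = v.degree :=
      (hm.degree_eq_sum_deg_support hw).symm.trans (hm.degree_eq_sum_deg_support hv)
    rw [hwc, hvc, Finsupp.degree_single, Finsupp.degree_single] at h1
    rw [hwc, hvc, h1]
  · intro h
    exact absurd hv h

theorem vanishingIdeal_mul_le (c : Fin (n + 1)) (a b : ℕ) :
    vanishingIdeal k c a * vanishingIdeal k c b ≤ vanishingIdeal k c (a + b) := by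
  rw [Ideal.mul_le]
  intro f hf g hg
  refine mem_vanishingIdeal.2 fun v hv => ?_
  obtain ⟨x, hx, y, hy, rfl⟩ := Finset.mem_add.1 (support_mul f g hv)
  have h1 := mem_vanishingIdeal.1 hf x hx
  have h2 := mem_vanishingIdeal.1 hg y hy
  rw [Finsupp.add_apply, map_add]
  omega

/-- The a-th power consists of the polynomials whose monomials have degree at least a in the
variables other than x_c, since those variables lie in the ideal of the point. -/
theorem coordIdeal_pow (c : Fin (n + 1)) (a : ℕ) : coordIdeal k c ^ a = vanishingIdeal k c a := by
  apply le_antisymm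
  · induction a with
    | zero =>
      intro f _
      exact mem_vanishingIdeal.2 fun v _ => Finsupp.le_degree c v
    | succ a ih =>
      rw [pow_succ]
      exact (Ideal.mul_mono ih (coordIdeal_le c)).trans (vanishingIdeal_mul_le c a 1)
  · intro f hf
    rw [f.as_sum]
    refine Ideal.sum_mem _ fun v hv => ?_
    have hv' := mem_vanishingIdeal.1 hf v hv
    have hdeg : v.degree = v c + ∑ i ∈ Finset.univ.erase c, v i := by
      rw [Finsupp.degree_eq_sum, Finset.add_sum_erase _ _ (Finset.mem_univ c)]
    rw [monomial_eq, Finsupp.prod_fintype _ _ (fun i => pow_zero _),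
      ← Finset.mul_prod_erase _ _ (Finset.mem_univ c)]
    refine Ideal.mul_mem_left _ _ (Ideal.mul_mem_left _ _ ?_)
    have hX : ∀ i ∈ Finset.univ.erase c, (X i : CoordRing k n) ^ v i ∈ coordIdeal k c ^ v i := by
      intro i hi
      have hi' : (X i : CoordRing k n) ∈ coordIdeal k c := by
        refine Ideal.subset_span ⟨⟨1, isHomogeneous_X _ _⟩, ?_⟩
        rw [eval_X, Pi.single_eq_of_ne (Finset.mem_erase.1 hi).1]
      exact Ideal.pow_mem_pow hi' _
    have := Ideal.prod_mem_prod hX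
    rw [Finset.prod_pow_eq_pow_sum] at this
    exact Ideal.pow_le_pow_right (by omega) this

/-- The exponents of the monomials in the ideal of fat points supported at coordinate points. -/
def fatExponents {r : ℕ} (c : Fin (r + 1) → Fin (n + 1)) (a : Fin (r + 1) → ℕ) :
    Set (Fin (n + 1) →₀ ℕ) :=
  {v | ∀ t, v (c t) + a t ≤ v.degree}

theorem map_coordIdeal {τ : CoordRing k n ≃ₐ[k] CoordRing k n} (hτ : IsGradedEquiv τ)
    {c : Fin (n + 1)} {P : ℙ k (Fin (n + 1) → k)}
    (hP : ∀ f, eval P.rep (τ f) = eval (Pi.single c 1) f) :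
    (coordIdeal k c).map τ = pointIdeal P := by
  rw [coordIdeal, Ideal.map_span, pointIdeal]
  congr 1
  ext g
  constructor
  · rintro ⟨f, ⟨⟨m, hm⟩, h0⟩, rfl⟩
    exact ⟨⟨m, (hτ f m).2 hm⟩, by rw [← h0]; exact hP f⟩
  · rintro ⟨⟨m, hm⟩, h0⟩
    refine ⟨τ.symm g, ⟨⟨m, (hτ.symm g m).2 hm⟩, ?_⟩, τ.apply_symm_apply g⟩
    rw [← hP, τ.apply_symm_apply, h0]

variable {r : ℕ} {P : Fin (r + 1) → ℙ k (Fin (n + 1) → k)} {a : Fin (r + 1) → ℕ}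
  {c : Fin (r + 1) → Fin (n + 1)} {τ : CoordRing k n ≃ₐ[k] CoordRing k n}

theorem apply_mem_fatPointIdeal_iff (hτ : IsGradedEquiv τ)
    (hP : ∀ t f, eval (P t).rep (τ f) = eval (Pi.single (c t) 1) f) {f : CoordRing k n} :
    τ f ∈ fatPointIdeal P a ↔ ∀ v ∈ f.support, v ∈ fatExponents c a := by
  have h : ∀ t, τ f ∈ pointIdeal (P t) ^ a t ↔ f ∈ vanishingIdeal k (c t) (a t) := by
    intro t
    rw [← map_coordIdeal hτ (hP t), ← Ideal.map_pow, coordIdeal_pow]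
    constructor
    · intro h
      obtain ⟨g, hg, hgf⟩ := (Ideal.mem_map_of_equiv τ _).1 h
      rwa [← τ.injective hgf]
    · intro h
      exact (Ideal.mem_map_of_equiv τ _).2 ⟨f, h, rfl⟩
  rw [fatPointIdeal, Submodule.mem_iInf]
  simp_rw [h, mem_vanishingIdeal]
  exact ⟨fun h v hv t => h t v hv, fun h t v hv => h v hv t⟩

theorem apply_mem_component_iff (hτ : IsGradedEquiv τ)
    (hP : ∀ t f, eval (P t).rep (τ f) = eval (Pi.single (c t) 1) f) {d : ℕ} {f : CoordRing k n} :
    τ f ∈ component (fatPointIdeal P a) d ↔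
      ∀ v ∈ f.support, ∃ w ∈ fatExponents c a ∩ {w | w.degree = d}, w ≤ v := by
  rw [← mem_ideal_span_monomial_image]
  have h : component (fatPointIdeal P a) d = (Ideal.span ((fun s => monomial s (1 : k)) ''
      (fatExponents c a ∩ {w | w.degree = d}))).map τ := by
    apply le_antisymm
    · refine Ideal.span_le.2 ?_
      rintro g ⟨hg, hd⟩
      refine (Ideal.mem_map_of_equiv τ _).2 ⟨τ.symm g, ?_, τ.apply_symm_apply g⟩
      rw [mem_ideal_span_monomial_image]
      intro v hv
      refine ⟨v, ⟨?_, ?_⟩, le_rfl⟩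
      · refine (apply_mem_fatPointIdeal_iff (f := τ.symm g) hτ hP).1 ?_ v hv
        rwa [τ.apply_symm_apply]
      · exact (((hτ.symm g d).2 hd).degree_eq_sum_deg_support hv).symm
    · rw [Ideal.map_span]
      refine Ideal.span_mono ?_
      rintro _ ⟨_, ⟨w, ⟨hw, hd⟩, rfl⟩, rfl⟩
      refine ⟨(apply_mem_fatPointIdeal_iff hτ hP).2 fun v hv => ?_,
        (hτ _ _).2 (isHomogeneous_monomial _ hd)⟩
      rwa [Finset.mem_singleton.1 (support_monomial_subset hv)]
  rw [h]
  constructor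
  · intro h
    obtain ⟨g, hg, hgf⟩ := (Ideal.mem_map_of_equiv τ _).1 h
    rwa [← τ.injective hgf]
  · intro h
    exact (Ideal.mem_map_of_equiv τ _).2 ⟨f, h, rfl⟩

/-- In a multidegree `u` off the linear strand some variable `X i` can be divided out of every
monomial of the ideal generated in degree `d`. -/
theorem exists_divisible_index (c : Fin (r + 1) → Fin (n + 1)) (a : Fin (r + 1) → ℕ) (d : ℕ)
    (u : Fin (n + 1) →₀ ℕ) : ∃ i, (u ≠ 0 → u i ≠ 0) ∧ ∀ v, v ≤ u → u i ≤ v i + 1 →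
      d ≤ v.degree → (∃ w ∈ fatExponents c a ∩ {w | w.degree = d}, w ≤ v + Finsupp.single i 1) →
      ∃ w ∈ fatExponents c a ∩ {w | w.degree = d}, w ≤ v := by
  -- In the first case choose i = c t: a monomial w of degree d in I has w_i ≤ d - a_t < u_i ≤ v_i +
  -- 1, so w already divides x^v.
  by_cases h : ∃ t, u (c t) ≠ 0 ∧ d < u (c t) + a t
  · obtain ⟨t, hu, ht⟩ := h
    refine ⟨c t, fun _ => hu, ?_⟩
    rintro v - huv - ⟨w, ⟨hw, rfl⟩, hwv⟩
    refine ⟨w, ⟨hw, rfl⟩, fun l => ?_⟩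
    by_cases hl : l = c t
    · subst hl
      have := hw t
      omega
    · have := hwv l
      rwa [Finsupp.add_apply, Finsupp.single_eq_of_ne hl, add_zero] at this
  · push Not at h
    have hex : ∃ i, u ≠ 0 → u i ≠ 0 := by
      by_cases hu : u = 0
      · exact ⟨0, fun h => absurd hu h⟩
      · obtain ⟨i, hi⟩ := Finsupp.ne_iff.1 hu
        exact ⟨i, fun _ => hi⟩
    obtain ⟨i, hi⟩ := hex
    refine ⟨i, hi, ?_⟩
    rintro v hvu - hdv ⟨w', ⟨hw', hd'⟩, -⟩
    -- Now u_{c_t} + a_t ≤ d whenever u_{c_t} ≠ 0, so any divisor of x^v of degree d lies in I. For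
    -- u_{c_t} = 0 the bound a_t ≤ d comes from the given w'.
    obtain ⟨w, hwv, hwd⟩ := Finsupp.exists_le_degree_eq v d hdv
    refine ⟨w, ⟨fun t => ?_, hwd⟩, hwv⟩
    have h1 := hwv (c t)
    have h2 := hvu (c t)
    have h3 := hw' t
    have h4 := h t
    simp only [Set.mem_ofPred_eq] at hd'
    by_cases h0 : u (c t) = 0
    · omega
    · have := h4 h0
      omega

theorem exists_koszulD_X_eq_of_fatExponents {p j d : ℕ} (hj : j ≠ d + p)
    {f : Finset (Fin (n + 1)) → CoordRing k n}
    (hf : koszulD (X : Fin (n + 1) → CoordRing k n) f = 0)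
    (hcard : ∀ S, S.card ≠ p → f S = 0)
    (hdeg : ∀ S, ∀ u ∈ (f S).support, u.degree + p = j)
    (hmem : ∀ S, ∀ u ∈ (f S).support, ∃ w ∈ fatExponents c a ∩ {w | w.degree = d}, w ≤ u) :
    ∃ g : Finset (Fin (n + 1)) → CoordRing k n,
      koszulD (X : Fin (n + 1) → CoordRing k n) g = f ∧ (∀ S, S.card ≠ p + 1 → g S = 0) ∧
      (∀ S, ∀ u ∈ (g S).support, u.degree + (p + 1) = j) ∧
      ∀ S, ∀ u ∈ (g S).support, ∃ w ∈ fatExponents c a ∩ {w | w.degree = d}, w ≤ u := by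
  have hcard' : ∀ S, ∀ v ∈ (f S).support, S.card = p := fun S v hv => by
    by_contra h
    simp [hcard S h] at hv
  -- A monomial of the ideal has degree j - p ≥ d, and equality is the excluded linear strand.
  have hlt : ∀ S, ∀ v ∈ (f S).support, d + p < j := fun S v hv => by
    obtain ⟨w, ⟨-, hwd⟩, hwv⟩ := hmem S v hv
    have h1 := Finsupp.degree_mono hwv
    have h2 := hdeg S v hv
    rw [Set.mem_ofPred_eq] at hwd
    omega
  choose e he1 he2 using exists_divisible_index c a d
  refine ⟨koszulHomotopy e f, koszulD_koszulHomotopy e f hf ?_, ?_, ?_, ?_⟩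
  · intro S v hv
    refine he1 _ fun h0 => ?_
    have h1 := congrArg Finsupp.degree h0
    rw [map_add, degree_squarefreeExponent, map_zero, hcard' S v hv] at h1
    have := hdeg S v hv
    have := hlt S v hv
    omega
  · intro S hS
    rw [← MvPolynomial.support_eq_empty, Finset.eq_empty_iff_forall_notMem]
    intro v hv
    obtain ⟨h1, h2⟩ := exists_of_mem_support_koszulHomotopy hv
    have h3 := hcard' _ _ h2
    have := Finset.card_erase_add_one h1
    omega
  · intro S v hv
    obtain ⟨h1, h2⟩ := exists_of_mem_support_koszulHomotopy hv
    have h3 := hdeg _ _ h2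
    rw [map_add, Finsupp.degree_single] at h3
    omega
  · intro S v hv
    obtain ⟨h1, h2⟩ := exists_of_mem_support_koszulHomotopy hv
    refine he2 _ v le_self_add ?_ ?_ (hmem _ _ h2)
    · rw [Finsupp.add_apply, squarefreeExponent_apply]
      split_ifs
      all_goals omega
    -- The strict inequality pays for the variable divided out: the quotient monomial still has
    -- degree at least d.
    · have h3 := hdeg _ _ h2
      have h4 := hlt _ _ h2
      rw [map_add, Finsupp.degree_single] at h3
      omega

/-- The ideals generated by the graded pieces of an ideal of fat points in general position have
linear resolutions. -/
theorem koszulDim_component_eq_zero (hτ : IsGradedEquiv τ)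
    (hP : ∀ t f, eval (P t).rep (τ f) = eval (Pi.single (c t) 1) f) {p j d : ℕ} (hj : j ≠ d + p) :
    koszulDim (fun i => τ (X i)) (idealStrand (component (fatPointIdeal P a) d) j) p = 0 := by
  refine koszulDim_eq_zero fun f hf => ?_
  have hf' : f = fun S => τ (τ.symm (f S)) := by simp
  obtain ⟨g, hg, hg1, hg2, hg3⟩ := exists_koszulD_X_eq_of_fatExponents (c := c) (a := a) hj
    (f := fun S => τ.symm (f S)) (p := p)
    (by
      have h0 := (mem_cycles.1 hf).2
      rw [hf', koszulD_algEquiv] at h0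
      funext S
      have := congrFun h0 S
      exact τ.injective (by rw [this]; simp))
    (fun S hS => by simp [(hf.1 S).2 hS])
    (fun S => hτ.symm.degree_add_iff.2 ((hf.1 S).1).2)
    (fun S => (apply_mem_component_iff (P := P) hτ hP).1 (by
      rw [τ.apply_symm_apply]; exact ((hf.1 S).1).1))
  refine ⟨fun S => τ (g S), fun S => ⟨⟨(apply_mem_component_iff hτ hP).2 (hg3 S),
    hτ.degree_add_iff.2 (hg2 S)⟩, fun hS => by simp [hg1 S hS]⟩, ?_⟩
  rw [LinearMap.restrictScalars_apply, koszulD_algEquiv, hg, ← hf']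

end Monomial

/-! ### Betti numbers of the graded components as dimensions of cycles -/

section Comparison

attribute [local instance] MvPolynomial.gradedAlgebra

variable {k : Type*} [Field k] {n : ℕ}

instance finiteDimensional_idealStrand (J : Ideal (CoordRing k n)) (j p : ℕ) :
    FiniteDimensional k (idealStrand J j p) := by
  have : FiniteDimensional k (homogeneousSubmodule (Fin (n + 1)) k (j - p)) :=
    Module.Finite.iff_fg.2 (homogeneousSubmodule_fg _ _ _)
  refine Submodule.finiteDimensional_of_le (S₂ := homogeneousSubmodule (Fin (n + 1)) k (j - p))
    fun f hf => ?_
  rcases forall_degree_add_iff.1 hf.2 with rfl | ⟨-, h⟩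
  · exact zero_mem _
  · exact h

theorem component_le (J : Ideal (CoordRing k n)) (d : ℕ) : component J d ≤ J :=
  Ideal.span_le.2 fun _ hf => hf.1

theorem idealStrand_component (J : Ideal (CoordRing k n)) (d p : ℕ) :
    idealStrand (component J d) (d + p) p = idealStrand J (d + p) p := by
  ext f
  refine ⟨fun hf => ⟨component_le J d hf.1, hf.2⟩, fun hf => ⟨?_, hf.2⟩⟩
  rcases forall_degree_add_iff.1 hf.2 with rfl | ⟨-, h⟩
  · exact zero_mem _
  · rw [Nat.add_sub_cancel] at h
    exact Ideal.subset_span ⟨hf.1, h⟩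

theorem cycles_congr {y : Fin (n + 1) → CoordRing k n} {𝒢 𝒢' : ℕ → Submodule k (CoordRing k n)}
    {p : ℕ} (h : 𝒢 p = 𝒢' p) : cycles y 𝒢 p = cycles y 𝒢' p := by
  ext f
  simp only [mem_cycles, mem_chains, h]

theorem coeff_zero_of_mem {J : Ideal (CoordRing k n)} (hJ : J ≠ ⊤)
    (hom : J.IsHomogeneous (homogeneousSubmodule (Fin (n + 1)) k)) :
    ∀ f ∈ J, coeff 0 f = 0 := by
  intro f hf
  by_contra h0
  refine hJ (Ideal.eq_top_of_isUnit_mem J (homogeneousComponent_mem_of_mem hom hf 0) ?_)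
  rw [homogeneousComponent_zero]
  exact (isUnit_iff_ne_zero.2 h0).map C

variable {r : ℕ} {P : Fin (r + 1) → ℙ k (Fin (n + 1) → k)} {a : Fin (r + 1) → ℕ}
  {c : Fin (r + 1) → Fin (n + 1)} {τ : CoordRing k n ≃ₐ[k] CoordRing k n}

theorem idealStrand_component_eq_bot (hτ : IsGradedEquiv τ)
    (hP : ∀ t f, eval (P t).rep (τ f) = eval (Pi.single (c t) 1) f) {d j p : ℕ} (h : j < d + p) :
    idealStrand (component (fatPointIdeal P a) d) j p = ⊥ := by
  rw [eq_bot_iff]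
  rintro f ⟨hf, hdeg⟩
  rw [← τ.apply_symm_apply f, apply_mem_component_iff hτ hP] at hf
  rw [Submodule.mem_bot, ← map_eq_zero_iff _ τ.symm.injective, ← MvPolynomial.support_eq_empty,
    Finset.eq_empty_iff_forall_notMem]
  intro v hv
  obtain ⟨w, ⟨-, hwd⟩, hwv⟩ := hf v hv
  have h1 := Finsupp.degree_mono hwv
  have h2 := hτ.symm.degree_add_iff.2 hdeg v hv
  rw [Set.mem_ofPred_eq] at hwd
  omega

/-- Linearity reduces the total Betti number to Koszul homology in degree d + p. There are no
boundaries there, and the cycles only see degree d, where I_{<d>} and I coincide. -/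
theorem betti_component (hτ : IsGradedEquiv τ)
    (hP : ∀ t f, eval (P t).rep (τ f) = eval (Pi.single (c t) 1) f)
    (h0 : ∀ f ∈ fatPointIdeal P a, coeff 0 f = 0) (d p : ℕ)
    (G : MinimalGradedFreeResolution (component (fatPointIdeal P a) d)) :
    G.betti (p + 1) = Module.finrank k
      (cycles (fun i => τ (X i)) (idealStrand (fatPointIdeal P a) (d + p)) p) := by
  have h0' : ∀ f ∈ component (fatPointIdeal P a) d, coeff 0 f = 0 := fun f hf =>
    h0 f (component_le _ d hf)
  rw [G.betti_eq_gradedBetti (j := d + p) fun j hj => by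
      rw [G.gradedBetti_succ hτ h0', koszulDim_component_eq_zero hτ hP hj],
    G.gradedBetti_succ hτ h0', koszulDim_of_chains_eq_bot
      (idealStrand_component_eq_bot hτ hP (by omega)),
    cycles_congr (idealStrand_component _ d p)]

end Comparison

end FatPoints

theorem theorem5p6 {k : Type*} [Field k] (n r : ℕ) (hr : r + 1 ≤ n + 1)
    (P : Fin (r + 1) → ℙ k (Fin (n + 1) → k)) (hP : Projectivization.Independent P)
    (a : Fin (r + 1) → ℕ) (ha : ∀ i, 1 ≤ a i)
    (F : FatPoints.MinimalGradedFreeResolution (FatPoints.fatPointIdeal P a))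
    (G : ∀ d : ℕ, FatPoints.MinimalGradedFreeResolution
      (FatPoints.component (FatPoints.fatPointIdeal P a) d)) :
    (∀ i d : ℕ, 1 ≤ i →
      (F.gradedBetti i (i + d) : ℤ) =
        ((G (d + 1)).betti i : ℤ) + ((G d).betti (i + 1) : ℤ)
          - ((G d).betti 1 : ℤ) * ((n + 1).choose i : ℤ)) ∧
    (∀ d : ℕ, F.gradedBetti 0 d = if d = 0 then 1 else 0) := by
  have h0 := FatPoints.coeff_zero_of_mem (FatPoints.fatPointIdeal_ne_top P a ha)
    (FatPoints.fatPointIdeal_isHomogeneous P a)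
  refine ⟨fun i d hi => ?_, F.gradedBetti_zero h0⟩
  obtain ⟨p, rfl⟩ : ∃ p, i = p + 1 := ⟨i - 1, by omega⟩
  -- A linear automorphism sends the representatives of the points to the first r + 1 coordinate
  -- vectors; composition with it is the change of coordinates τ. The resolutions stay put: only the
  -- Koszul variables change.
  have hE : LinearIndependent k fun t : Fin (r + 1) =>
      (Pi.single (Fin.castLE hr t) 1 : Fin (n + 1) → k) :=
    (Pi.linearIndependent_single_one (Fin (n + 1)) k).comp _ (Fin.castLE_injective hr)
  obtain ⟨L, hL⟩ := FatPoints.exists_linearEquiv_apply_eq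
    (Projectivization.independent_iff.1 hP) hE
  have hτ := FatPoints.isGradedEquiv_linearSubstEquiv L
  have hPτ : ∀ t f, eval (P t).rep (FatPoints.linearSubstEquiv L f) =
      eval (Pi.single (Fin.castLE hr t) 1) f := fun t f => by
    rw [← hL t]
    exact FatPoints.eval_linearSubst _ _ f
  have h1 := FatPoints.betti_component hτ hPτ h0 (d + 1) p (G (d + 1))
  have h2 := FatPoints.betti_component hτ hPτ h0 d (p + 1) (G d)
  have h3 := FatPoints.betti_component hτ hPτ h0 d 0 (G d)
  have h4 := F.gradedBetti_succ hτ h0 p (p + 1 + d)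
  have h5 := FatPoints.koszulDim_add_finrank_boundaries
    (FatPoints.smul_mem_idealStrand hτ.isHomogeneous_X (FatPoints.fatPointIdeal P a) (p + 1 + d)) p
  have h6 := FatPoints.finrank_boundaries_add_finrank_cycles
    (fun i => FatPoints.linearSubstEquiv L (X i))
    (FatPoints.idealStrand (FatPoints.fatPointIdeal P a) (p + 1 + d)) p
  -- Both sides are I_d, so `h3` turns β₁(R/I_{<d>}) into the dimension of the coefficients of the
  -- (p+1)-chains.
  have h7 : FatPoints.idealStrand (FatPoints.fatPointIdeal P a) (p + 1 + d) (p + 1) =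
      FatPoints.idealStrand (FatPoints.fatPointIdeal P a) (d + 0) 0 := by
    ext f
    simp only [FatPoints.mem_idealStrand, add_comm (p + 1) d, add_zero, add_left_inj]
  rw [FatPoints.cycles_zero, FatPoints.finrank_chains, Nat.choose_zero_right, one_mul, ← h7] at h3
  rw [show d + 1 + p = p + 1 + d by omega] at h1
  rw [show d + (p + 1) = p + 1 + d by omega] at h2
  rw [← h3, ← h2, Fintype.card_fin] at h6
  rw [← h4, ← h1] at h5
  rw [zero_add] at h6
  zify at h5 h6
  linear_combination h5 - h6
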